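/- Let $d,K_0,K_1\ge 1$. For $i\in\{0,1\}$ let $\mu_i=\sum_{k=1}^{K_i}\pi_i^k\mu_i^k$ be a Gaussian mixture on $\mathbb R^d$, where $\pi_i^k\ge 0$, $\sum_k\pi_i^k=1$, and $\mu_i^k=\mathcal N(m_i^k,\Sigma_i^k)$ with $\Sigma_i^k$ symmetric positive semidefinite (possibly singular; Dirac masses count as Gaussian). Write $GMM_n(K)$ for the set of Gaussian mixtures on $\mathbb R^n$ with at most $K$ components and $GMM_n(\infty)=\bigcup_K GMM_n(K)$. Let $\Pi(\mu,\nu)$ be the set of measures on $\mathbb R^d\times\mathbb R^d$ with marginals $\mu,\nu$, and set $$W_2^2(\mu,\nu)=\inf_{\gamma\in\Pi(\mu,\nu)}\int\|x-y\|^2d\gamma,\qquad MW_2^2(\mu,\nu)=\inf_{\gamma\in\Pi(\mu,\nu)\cap GMM_{2d}(\infty)}\int\|x-y\|^2d\gamma .$$ A plan attaining the first (resp. second) infimum is called $W_2$-optimal (resp. $MW_2$-optimal). Let $P_t(x,y)=(1-t)x+ty$. A displacement interpolation between $\mu$ and $\nu$ is a path $(P_t\#\gamma)_{t\in[0,1]}$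 with $\gamma$ a $W_2$-optimal plan between $\mu$ and $\nu$. A nonnegative $K_0\times K_1$ matrix $w^*$ is called optimal if it minimizes $\sum_{k,l}w_{kl}W_2^2(\mu_0^k,\mu_1^l)$ over all nonnegative matrices $w$ with row sums $\pi_0^k$ and column sums $\pi_1^l$. Then: 1. For every $MW_2$-optimal plan $\gamma^*$ between $\mu_0$ and $\mu_1$, the barycenters $\mu_t=P_t\#\gamma^*$, $t\in[0,1]$, all belong to $GMM_d(\infty)$, and there are an optimal $w^*$ and displacement interpolations $(\mu_t^{kl})_{t\in[0,1]}$ between $\mu_0^k$ and $\mu_1^l$ such that $$\mu_t=\sum_{k,l}w^*_{kl}\,\mu_t^{kl}\qquad\text{for all } t\in[0,1].$$ 2. Conversely, for every optimal $w^*$ there are an $MW_2$-optimal plan $\gamma^*$ and displacement interpolations $(\mu_t^{kl})_t$ between $\mu_0^k$ and $\mu_1^l$, with every $\mu_t^{kl}$ Gaussian, such that $P_t\#\gamma^*=\sum_{k,l}w^*_{kl}\mu_t^{kl}$ for all $t\in[0,1]$. 3. If $\Sigma_0^k$ is nonsingular, let $$T_{kl}(x)=m_1^l+(\Sigma_0^k)^{-1/2}\big((\Sigma_0^k)^{1/2}\Sigma_1^l(\Sigma_0^k)^{1/2}\big)^{1/2}(\Sigma_0^k)^{-1/2}(x-m_0^k).$$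 Then $(\mathrm{Id},T_{kl})\#\mu_0^k$ is a $W_2$-optimal plan between $\mu_0^k$ and $\mu_1^l$, and every displacement interpolation between $\mu_0^k$ and $\mu_1^l$ is given by $\mu_t^{kl}=((1-t)\mathrm{Id}+tT_{kl})\#\mu_0^k$, $t\in[0,1]$. 4. The plan can be chosen so that the barycenters have at most $K_0+K_1-1$ components: there are an optimal $w^*$ with at most $K_0+K_1-1$ nonzero entries, an $MW_2$-optimal plan $\gamma^*\in GMM_{2d}(K_0+K_1-1)$, and displacement interpolations $(\mu_t^{kl})_t$ consisting of Gaussian measures, such that for all $t\in[0,1]$, $P_t\#\gamma^*=\sum_{k,l}w^*_{kl}\mu_t^{kl}\in GMM_d(K_0+K_1-1)$. -/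

import Mathlib

open MeasureTheory ProbabilityTheory Set
open scoped NNReal ENNReal MatrixOrder

noncomputable section

namespace GMMTransport

/-- `ℝ^d` with its Euclidean norm. -/
abbrev Rd (d : ℕ) : Type := EuclideanSpace ℝ (Fin d)

section General

variable {E : Type*} [TopologicalSpace E] [AddCommMonoid E] [Module ℝ E] [MeasurableSpace E]

/-- `μ` is a Gaussian mixture with at most `K` components: weights may vanish, and components may
be degenerate Gaussians (for instance Dirac masses). -/
def IsGMM (K : ℕ) (μ : Measure E) : Prop :=
  ∃ (π : Fin K → ℝ≥0) (ν : Fin K → Measure E),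
    ∑ k, π k = 1 ∧ (∀ k, IsGaussian (ν k)) ∧ μ = ∑ k, π k • ν k

/-- `μ` is a finite Gaussian mixture. -/
def IsFiniteGMM (μ : Measure E) : Prop := ∃ K : ℕ, IsGMM K μ

end General

variable {d : ℕ}

/-- `γ` is a transport plan: a measure on `ℝ^d × ℝ^d` with marginals `μ` and `ν`. -/
def IsPlan (μ ν : Measure (Rd d)) (γ : Measure (Rd d × Rd d)) : Prop :=
  γ.map Prod.fst = μ ∧ γ.map Prod.snd = ν

/-- The quadratic transport cost `∫ ‖x - y‖² dγ(x, y)`. -/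
def cost (γ : Measure (Rd d × Rd d)) : ℝ≥0∞ := ∫⁻ p, ‖p.1 - p.2‖ₑ ^ 2 ∂γ

/-- The squared Wasserstein distance `W₂²`. -/
def W2sq (μ ν : Measure (Rd d)) : ℝ≥0∞ :=
  ⨅ γ : {γ : Measure (Rd d × Rd d) // IsPlan μ ν γ}, cost γ.1

/-- `γ` is an optimal transport plan for `W₂`. -/
def IsW2Optimal (μ ν : Measure (Rd d)) (γ : Measure (Rd d × Rd d)) : Prop :=
  IsPlan μ ν γ ∧ cost γ = W2sq μ ν

/-- The squared mixture Wasserstein distance `MW₂²`: plans are restricted to finite Gaussian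
mixtures on `ℝ^d × ℝ^d`. -/
def MW2sq (μ ν : Measure (Rd d)) : ℝ≥0∞ :=
  ⨅ γ : {γ : Measure (Rd d × Rd d) // IsPlan μ ν γ ∧ IsFiniteGMM γ}, cost γ.1

/-- `γ` is an optimal transport plan for `MW₂`. -/
def IsMW2Optimal (μ ν : Measure (Rd d)) (γ : Measure (Rd d × Rd d)) : Prop :=
  IsPlan μ ν γ ∧ IsFiniteGMM γ ∧ cost γ = MW2sq μ ν

/-- `P_t (x, y) = (1 - t) x + t y`. -/
def P (t : ℝ) (p : Rd d × Rd d) : Rd d := (1 - t) • p.1 + t • p.2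

/-- The path `ρ` on `[0, 1]` is a `W₂` displacement interpolation between `μ` and `ν`. -/
def IsDisplacementInterpolation (μ ν : Measure (Rd d)) (ρ : ℝ → Measure (Rd d)) : Prop :=
  ∃ γ, IsW2Optimal μ ν γ ∧ ∀ t ∈ Icc (0 : ℝ) 1, ρ t = γ.map (P t)

/-- The affine map
`x ↦ m₁ + S₀^{-1/2} (S₀^{1/2} S₁ S₀^{1/2})^{1/2} S₀^{-1/2} (x - m₀)`. -/
def gaussianMap (m₀ : Rd d) (S₀ : Matrix (Fin d) (Fin d) ℝ)
    (m₁ : Rd d) (S₁ : Matrix (Fin d) (Fin d) ℝ) (x : Rd d) : Rd d :=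
  m₁ + Matrix.toEuclideanCLM (𝕜 := ℝ)
    ((CFC.sqrt S₀)⁻¹ * CFC.sqrt (CFC.sqrt S₀ * S₁ * CFC.sqrt S₀) * (CFC.sqrt S₀)⁻¹) (x - m₀)

variable {K₀ K₁ : ℕ}

/-- The matrix `w` of nonnegative weights has marginals `π₀` and `π₁`. -/
def IsWeightPlan (π₀ : Fin K₀ → ℝ≥0) (π₁ : Fin K₁ → ℝ≥0) (w : Fin K₀ → Fin K₁ → ℝ≥0) : Prop :=
  (∀ k, ∑ l, w k l = π₀ k) ∧ ∀ l, ∑ k, w k l = π₁ l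

/-- The discrete cost `∑ w_{kl} W₂²(μ₀^k, μ₁^l)`. -/
def discreteCost (μ₀ : Fin K₀ → Measure (Rd d)) (μ₁ : Fin K₁ → Measure (Rd d))
    (w : Fin K₀ → Fin K₁ → ℝ≥0) : ℝ≥0∞ :=
  ∑ k, ∑ l, (w k l : ℝ≥0∞) * W2sq (μ₀ k) (μ₁ l)

/-- `w` minimizes the discrete cost among the weight matrices with marginals `π₀` and `π₁`. -/
def IsOptimalWeight (π₀ : Fin K₀ → ℝ≥0) (π₁ : Fin K₁ → ℝ≥0)
    (μ₀ : Fin K₀ → Measure (Rd d)) (μ₁ : Fin K₁ → Measure (Rd d))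
    (w : Fin K₀ → Fin K₁ → ℝ≥0) : Prop :=
  IsWeightPlan π₀ π₁ w ∧
    ∀ w', IsWeightPlan π₀ π₁ w' → discreteCost μ₀ μ₁ w ≤ discreteCost μ₀ μ₁ w'

/-- The number of pairs `(k, l)` with `w_{kl} ≠ 0`. -/
def supportCard (w : Fin K₀ → Fin K₁ → ℝ≥0) : ℕ := {p : Fin K₀ × Fin K₁ | w p.1 p.2 ≠ 0}.ncard

end GMMTransport

end

open GMMTransport

/-! The problem reduces to a finite transport problem between components, with costs `W2sq (ν₀ k)
(ν₁ l)`. Gluing Gaussian optimal plans between components with weights `w` gives a mixture plan of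
cost `discreteCost ν₀ ν₁ w`, so `MW2sq` is at most the discrete minimum. Conversely, the components
of a Gaussian mixture plan have Gaussian marginals, and finite Gaussian mixtures are identifiable
(`sum_weights_eq_of_mixture_eq`); hence every component of positive weight joins some `ν₀ k` to some
`ν₁ l`, and the plan splits as `∑ w k l • Γ k l` (`exists_plan_decomposition`), with cost at least
the discrete cost of `w`. For an optimal plan all inequalities are equalities, so `w` is optimal and
`Γ k l` is optimal wherever `w k l ≠ 0`. Since `P t` is linear, pushing forward preserves both the
mixture structure and Gaussianity.

Gaussian optimal plans exist because the cost of a plan depends only on its means and joint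
covariance: the admissible covariances form a compact set, and each of them is realized by a
Gaussian plan (`exists_isGaussian_isW2Optimal`). For nonsingular `S₀`, completing the square writes
the cost as a constant plus the integral of a nonnegative defect that vanishes only on the graph of
the affine map (`isW2Optimal_map_and_unique`). The bound `K₀ + K₁ - 1` is the support size of a
vertex of the transportation polytope. -/

namespace GMMTransport

/-! ### Identifiability of finite Gaussian mixtures -/

section Identifiability

open Filter Topology

/-- The functions `s ↦ exp (b s² + a s)`, for distinct `(b, a)`, are linearly independent. -/
theorem eq_zero_of_sum_mul_exp_quadratic_eq_zero (T : Finset (ℝ ×ₗ ℝ)) (c : ℝ ×ₗ ℝ → ℝ)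
    (h : ∀ s : ℝ, ∑ p ∈ T, c p * Real.exp ((ofLex p).1 * s ^ 2 + (ofLex p).2 * s) = 0) :
    ∀ p ∈ T, c p = 0 := by
  induction T using Finset.induction_on_max with
  | empty => simp
  | insert p T hp ih =>
    have hpT : p ∉ T := fun hm => lt_irrefl _ (hp p hm)
    -- The lexicographically largest pair `p` dominates as `s → +∞`: after division by its
    -- exponential every other term tends to `0`, which leaves `c p = 0`.
    have hlim : ∀ q ∈ T, Tendsto (fun s : ℝ => c q *
        Real.exp (((ofLex q).1 - (ofLex p).1) * s ^ 2 + ((ofLex q).2 - (ofLex p).2) * s))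
        atTop (𝓝 0) := by
      intro q hq
      rw [← mul_zero (c q)]
      refine Tendsto.const_mul _ (Real.tendsto_exp_atBot.comp ?_)
      rcases Prod.Lex.lt_iff.1 (hp q hq) with h1 | ⟨h1, h2⟩
      · have : (fun s : ℝ => ((ofLex q).1 - (ofLex p).1) * s ^ 2 +
            ((ofLex q).2 - (ofLex p).2) * s) =
            fun s => s * (((ofLex q).1 - (ofLex p).1) * s + ((ofLex q).2 - (ofLex p).2)) := by
          funext s; ring
        rw [this]
        refine tendsto_id.atTop_mul_atBot₀ ?_
        exact tendsto_atBot_add_const_right _ _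
          (tendsto_id.const_mul_atTop_of_neg (sub_neg.2 h1))
      · simp only [h1, sub_self, zero_mul, zero_add]
        exact tendsto_id.const_mul_atTop_of_neg (sub_neg.2 h2)
    have hsum := tendsto_finsetSum T hlim
    have hconst : ∀ s : ℝ, ∑ q ∈ T, c q *
        Real.exp (((ofLex q).1 - (ofLex p).1) * s ^ 2 + ((ofLex q).2 - (ofLex p).2) * s)
        = - c p := by
      intro s
      have h1 := h s
      rw [Finset.sum_insert hpT] at h1
      have h2 : ∑ q ∈ T, c q *
          Real.exp (((ofLex q).1 - (ofLex p).1) * s ^ 2 + ((ofLex q).2 - (ofLex p).2) * s)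
          = (∑ q ∈ T, c q * Real.exp ((ofLex q).1 * s ^ 2 + (ofLex q).2 * s)) *
            (Real.exp ((ofLex p).1 * s ^ 2 + (ofLex p).2 * s))⁻¹ := by
        rw [Finset.sum_mul]
        refine Finset.sum_congr rfl fun q _ => ?_
        rw [mul_assoc, ← Real.exp_neg, ← Real.exp_add]
        ring_nf
      rw [h2, eq_neg_of_add_eq_zero_right h1]
      field_simp
    have hcp : c p = 0 := by
      have := tendsto_nhds_unique (hsum.congr hconst) tendsto_const_nhds
      simpa using this.symm
    intro q hq
    rcases Finset.mem_insert.1 hq with rfl | hq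
    · exact hcp
    · refine ih (fun s => ?_) q hq
      have h1 := h s
      rwa [Finset.sum_insert hpT, hcp, zero_mul, zero_add] at h1

/-- Finitely many functions, each quadratic along every line and somewhere nonzero, are
simultaneously nonzero at some point. -/
theorem exists_forall_ne_zero_of_quadratic_on_lines {V ι : Type*} [AddCommGroup V] [Module ℝ V]
    (F : Finset ι) (D : ι → V → ℝ)
    (hquad : ∀ i v w, ∃ a b c : ℝ, ∀ s : ℝ, D i (v + s • w) = a * s ^ 2 + b * s + c)
    (hne : ∀ i ∈ F, ∃ v, D i v ≠ 0) : ∃ v, ∀ i ∈ F, D i v ≠ 0 := by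
  classical
  induction F using Finset.induction_on with
  | empty => exact ⟨0, by simp⟩
  | insert i F hi ih =>
    obtain ⟨v, hv⟩ := ih fun j hj => hne j (Finset.mem_insert_of_mem hj)
    obtain ⟨u, hu⟩ := hne i (Finset.mem_insert_self _ _)
    -- On the line from `v` to `u` each function is a polynomial that is nonzero at `s = 0` (the old
    -- indices) or at `s = 1` (the new one), so it has finitely many roots.
    have hfin : ∀ j ∈ insert i F, {s : ℝ | D j (v + s • (u - v)) = 0}.Finite := by
      intro j hj
      obtain ⟨a, b, c, habc⟩ := hquad j v (u - v)
      set q : Polynomial ℝ := .C a * .X ^ 2 + .C b * .X + .C c with hq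
      have hev : ∀ s, q.eval s = D j (v + s • (u - v)) := fun s => by simp [hq, habc]
      have hq0 : q ≠ 0 := by
        intro h0
        rw [h0] at hev
        rcases Finset.mem_insert.1 hj with rfl | hj
        · exact hu (by simpa using (hev 1).symm)
        · exact hv j hj (by simpa using (hev 0).symm)
      refine (q.rootSet_finite ℝ).subset fun s hs => ?_
      simp only [mem_ofPred_eq] at hs
      simp [Polynomial.mem_rootSet, hq0, hev, hs]
    have hfin' : (⋃ j ∈ insert i F, {s : ℝ | D j (v + s • (u - v)) = 0}).Finite :=
      (Finset.finite_toSet _).biUnion hfin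
    obtain ⟨s, hs⟩ := hfin'.exists_notMem
    refine ⟨v + s • (u - v), fun j hj h0 => hs ?_⟩
    simp only [mem_iUnion, mem_ofPred_eq]
    exact ⟨j, hj, h0⟩

variable {E : Type*} [NormedAddCommGroup E] [InnerProductSpace ℝ E] [FiniteDimensional ℝ E]
  [MeasurableSpace E] [BorelSpace E]

/-- The cumulant generating function of a Gaussian measure. -/
noncomputable def gaussianCgf (μ : Measure E) (v : E) : ℝ :=
  inner ℝ v (μ[id]) + covarianceBilin μ v v / 2

/-- Evaluating at `t` and `-t` separates the odd part, which is the mean, from the even part, which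
is the covariance. -/
theorem eq_of_gaussianCgf_eq {μ ν : Measure E} [IsGaussian μ] [IsGaussian ν]
    (h : ∀ v, gaussianCgf μ v = gaussianCgf ν v) : μ = ν := by
  apply Measure.ext_of_charFun
  ext t
  have h1 := h t
  have h2 := h (-t)
  simp only [gaussianCgf, inner_neg_left, map_neg, neg_apply, neg_neg] at h1 h2
  have h3 : inner ℝ t (μ[id]) = inner ℝ t (ν[id]) := by linarith
  have h4 : covarianceBilin μ t t = covarianceBilin ν t t := by linarith
  rw [IsGaussian.charFun_eq', IsGaussian.charFun_eq', h3, h4]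

/-- Real exponential moments are preferred to characteristic functions because they can be told
apart by their growth along a line. -/
theorem lintegral_exp_inner_eq (μ : Measure E) [IsGaussian μ] (v : E) :
    ∫⁻ x, ENNReal.ofReal (Real.exp (inner ℝ v x)) ∂μ
      = ENNReal.ofReal (Real.exp (gaussianCgf μ v)) := by
  have hmap := IsGaussian.map_eq_gaussianReal (μ := μ) (innerSL ℝ v)
  set m := μ[innerSL ℝ v]
  set V := Var[innerSL ℝ v; μ] with hV
  have hm : m = inner ℝ v (μ[id]) :=
    (innerSL ℝ v).integral_comp_id_comm IsGaussian.integrable_id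
  have hV2 : V = covarianceBilin μ v v := by
    rw [covarianceBilin_self IsGaussian.memLp_two_id]; rfl
  have hV0 : 0 ≤ V := variance_nonneg _ _
  have h1 : ∫⁻ x, ENNReal.ofReal (Real.exp (inner ℝ v x)) ∂μ =
      ∫⁻ y, ENNReal.ofReal (Real.exp y) ∂(gaussianReal m V.toNNReal) := by
    rw [← hmap, lintegral_map (by fun_prop) (by fun_prop)]
    rfl
  have hint : Integrable (fun y : ℝ => Real.exp y) (gaussianReal m V.toNNReal) := by
    simpa using integrable_exp_mul_gaussianReal (μ := m) (v := V.toNNReal) 1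
  rw [h1, ← ofReal_integral_eq_lintegral_ofReal hint (ae_of_all _ fun _ => (Real.exp_pos _).le)]
  have h2 := congrFun (mgf_id_gaussianReal (μ := m) (v := V.toNNReal)) 1
  simp only [mgf, id_eq, one_mul, mul_one, one_pow] at h2
  rw [h2, gaussianCgf, hm, ← hV2, Real.coe_toNNReal _ hV0]

/-- A single direction `v` can be chosen at which distinct Gaussians among the `g i` have distinct
cumulant values. Along `s • v` the claim becomes the one-variable independence of `exp (b s² + a
s)`, with terms grouped by their coefficients, that is, by the measure `g i`. -/
theorem sum_eq_zero_of_sum_mul_exp_gaussianCgf_eq_zero {ι : Type*} [Fintype ι]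
    (g : ι → Measure E) (hg : ∀ i, IsGaussian (g i)) (c : ι → ℝ)
    (h : ∀ v, ∑ i, c i * Real.exp (gaussianCgf (g i) v) = 0) (κ : Measure E) :
    (∑ i, open Classical in if g i = κ then c i else 0) = 0 := by
  classical
  obtain ⟨v, hv⟩ := exists_forall_ne_zero_of_quadratic_on_lines
    (Finset.univ.filter fun p : ι × ι => g p.1 ≠ g p.2)
    (fun p v => gaussianCgf (g p.1) v - gaussianCgf (g p.2) v)
    (by
      intro p v w
      refine ⟨covarianceBilin (g p.1) w w / 2 - covarianceBilin (g p.2) w w / 2,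
        inner ℝ w ((g p.1)[id]) + covarianceBilin (g p.1) v w
          - (inner ℝ w ((g p.2)[id]) + covarianceBilin (g p.2) v w),
        gaussianCgf (g p.1) v - gaussianCgf (g p.2) v, fun s => ?_⟩
      simp only [gaussianCgf, inner_add_left, real_inner_smul_left, map_add, map_smul,
        add_apply, smul_apply, smul_eq_mul,
        covarianceBilin_comm w v]
      ring)
    (by
      intro p hp
      by_contra! hcon
      have := hg p.1
      have := hg p.2
      exact (Finset.mem_filter.1 hp).2 (eq_of_gaussianCgf_eq fun v => sub_eq_zero.1 (hcon v)))
  set φ : ι → ℝ ×ₗ ℝ := fun i =>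
    toLex (covarianceBilin (g i) v v / 2, inner ℝ v ((g i)[id])) with hφ
  have hφg : ∀ i j, φ i = φ j ↔ g i = g j := by
    intro i j
    refine ⟨fun hij => ?_, fun hij => by simp [hφ, hij]⟩
    by_contra hne
    refine hv (i, j) (by simpa using hne) ?_
    have h1 := congrArg (fun p => (ofLex p).1) hij
    have h2 := congrArg (fun p => (ofLex p).2) hij
    simp only [hφ, ofLex_toLex] at h1 h2
    simp only [gaussianCgf]
    linarith
  have key := eq_zero_of_sum_mul_exp_quadratic_eq_zero (Finset.univ.image φ)
    (fun p => ∑ i, if φ i = p then c i else 0) (by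
      intro s
      refine Eq.trans ?_ (h (s • v))
      rw [← Finset.sum_fiberwise_of_maps_to
        (fun i _ => Finset.mem_image_of_mem φ (Finset.mem_univ i))]
      refine Finset.sum_congr rfl fun p _ => ?_
      rw [Finset.sum_mul, Finset.sum_filter]
      refine Finset.sum_congr rfl fun i _ => ?_
      split_ifs with hip
      · rw [← hip]
        simp only [hφ, gaussianCgf, ofLex_toLex, real_inner_smul_left, map_smul,
          smul_apply, smul_eq_mul]
        ring_nf
      · simp)
  by_cases hκ : ∃ j, g j = κ
  · obtain ⟨j, rfl⟩ := hκ
    have := key (φ j) (Finset.mem_image_of_mem φ (Finset.mem_univ j))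
    simpa only [hφg] using this
  · push Not at hκ
    simp [hκ]

/-- Two representations of the same finite Gaussian mixture give the same total weight to every
Gaussian measure. -/
theorem sum_weights_eq_of_mixture_eq {J K : Type*} [Fintype J] [Fintype K]
    (g : J → Measure E) (hg : ∀ j, IsGaussian (g j)) (a : J → ℝ≥0)
    (ν : K → Measure E) (hν : ∀ k, IsGaussian (ν k)) (b : K → ℝ≥0)
    (h : ∑ j, a j • g j = ∑ k, b k • ν k) (κ : Measure E) :
    (∑ j, open Classical in if g j = κ then a j else 0) =
      ∑ k, open Classical in if ν k = κ then b k else 0 := by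
  classical
  have hexp : ∀ v, ∑ j, (a j : ℝ) * Real.exp (gaussianCgf (g j) v) =
      ∑ k, (b k : ℝ) * Real.exp (gaussianCgf (ν k) v) := by
    intro v
    have h1 := congrArg (fun μ => ∫⁻ x, ENNReal.ofReal (Real.exp (inner ℝ v x)) ∂μ) h
    simp only [lintegral_finsetSum_measure, lintegral_smul_measure, lintegral_exp_inner_eq] at h1
    have h2 := congrArg ENNReal.toReal h1
    rw [ENNReal.toReal_sum (by simp [ENNReal.smul_def, ENNReal.mul_ne_top]),
      ENNReal.toReal_sum (by simp [ENNReal.smul_def, ENNReal.mul_ne_top])] at h2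
    simpa [ENNReal.smul_def, ENNReal.toReal_ofReal (Real.exp_pos _).le] using h2
  -- The two representations are subtracted: one family over the disjoint union, with weights `a`
  -- and `-b`.
  have := sum_eq_zero_of_sum_mul_exp_gaussianCgf_eq_zero (Sum.elim g ν)
    (by rintro (j | k); exacts [hg j, hν k]) (Sum.elim (fun j => (a j : ℝ)) fun k => -(b k : ℝ))
    (by intro v; simp [Fintype.sum_sum_type, hexp v]) κ
  have hsum : (∑ j, if g j = κ then (a j : ℝ) else 0) +
      ∑ k, (if ν k = κ then -(b k : ℝ) else 0) = 0 := by
    rwa [Fintype.sum_sum_type] at this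
  apply NNReal.coe_injective
  simp only [← Finset.sum_filter, Finset.sum_neg_distrib] at hsum ⊢
  push_cast
  exact sub_eq_zero.1 ((sub_eq_add_neg _ _).trans hsum)

end Identifiability

/-! ### Finite mixtures -/

section Mixture

theorem map_sum_smul {ι α β : Type*} [Fintype ι] [MeasurableSpace α] [MeasurableSpace β]
    (c : ι → ℝ≥0) (μ : ι → Measure α) {f : α → β} (hf : Measurable f) :
    (∑ i, c i • μ i).map f = ∑ i, c i • (μ i).map f := by
  rw [Measure.map_finset_sum' hf.aemeasurable]
  simp [Measure.map_smul]

theorem map_sum_sum_smul {ι κ α β : Type*} [Fintype ι] [Fintype κ] [MeasurableSpace α]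
    [MeasurableSpace β] (c : ι → κ → ℝ≥0) (μ : ι → κ → Measure α) {f : α → β}
    (hf : Measurable f) :
    (∑ i, ∑ j, c i j • μ i j).map f = ∑ i, ∑ j, c i j • (μ i j).map f := by
  rw [Measure.map_finset_sum' hf.aemeasurable]
  simp [map_sum_smul _ _ hf]

theorem sum_extend_subtype {ι κ M : Type*} [Fintype ι] [Fintype κ] [AddCommMonoid M] {p : ι → Prop}
    (e : {i // p i} ↪ κ) (F : ι → M) (hF : ∀ i, ¬ p i → F i = 0) :
    ∑ n, Function.extend e (fun i => F i) 0 n = ∑ i, F i := by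
  classical
  rw [← Finset.sum_subset (Finset.subset_univ (Finset.univ.map e)), Finset.sum_map]
  · simp only [e.injective.extend_apply]
    rw [← Finset.sum_subtype (Finset.univ.filter p) (by simp), Finset.sum_filter_of_ne]
    exact fun i _ h => not_not.1 fun h0 => h (hF i h0)
  · intro n _ hn
    rw [Function.extend_apply']
    · rfl
    · rintro ⟨i, rfl⟩
      simp at hn

theorem isGMM_sum_of_card_le {E ι : Type*} [TopologicalSpace E] [AddCommMonoid E] [Module ℝ E]
    [MeasurableSpace E] [Fintype ι] {N : ℕ} (w : ι → ℝ≥0) (g : ι → Measure E)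
    (hw : ∑ i, w i = 1) (hg : ∀ i, IsGaussian (g i)) (hN : {i | w i ≠ 0}.ncard ≤ N) :
    IsGMM N (∑ i, w i • g i) := by
  classical
  have hcard : Fintype.card {i // w i ≠ 0} ≤ Fintype.card (Fin N) := by
    rw [Fintype.card_fin, ← Nat.card_eq_fintype_card]
    exact hN
  obtain ⟨e⟩ := Function.Embedding.nonempty_of_card_le hcard
  -- The unused slots of `Fin N` get weight zero but must still carry a Gaussian measure; `g i₀` is
  -- the filler.
  obtain ⟨i₀⟩ : Nonempty ι := by
    by_contra hne
    rw [not_nonempty_iff] at hne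
    simp at hw
  refine ⟨Function.extend e (fun i => w i) 0, Function.extend e (fun i => g i) fun _ => g i₀,
    ?_, ?_, ?_⟩
  · rw [sum_extend_subtype e w fun _ h => not_not.1 h, hw]
  · intro n
    by_cases hn : ∃ i, e i = n
    · obtain ⟨i, rfl⟩ := hn
      rw [e.injective.extend_apply]
      exact hg _
    · rw [Function.extend_apply' _ _ _ hn]
      exact hg _
  · rw [← sum_extend_subtype e (fun i => w i • g i) fun i h => by simp [not_not.1 h]]
    refine Finset.sum_congr rfl fun n _ => ?_
    by_cases hn : ∃ i, e i = n
    · obtain ⟨i, rfl⟩ := hn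
      simp only [e.injective.extend_apply]
    · simp only [Function.extend_apply' _ _ _ hn]
      simp

theorem IsGMM.map {E F : Type*} [NormedAddCommGroup E] [NormedSpace ℝ E] [MeasurableSpace E]
    [BorelSpace E] [NormedAddCommGroup F] [NormedSpace ℝ F] [MeasurableSpace F] [BorelSpace F]
    {K : ℕ} {μ : Measure E} (h : IsGMM K μ) (L : E →L[ℝ] F) : IsGMM K (μ.map L) := by
  obtain ⟨π, ν, hπ, hν, rfl⟩ := h
  refine ⟨π, fun k => (ν k).map L, hπ, fun k => ?_, map_sum_smul _ _ (by fun_prop)⟩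
  have := hν k
  infer_instance

/-- If the fibres of two labelled families of weights have the same total weights, then each
weight of the first family can be distributed over the weights of the second one with the same
label. -/
theorem exists_distribution {J K L : Type*} [Fintype J] [Fintype K] (a : J → ℝ≥0) (α : J → L)
    (b : K → ℝ≥0) (β : K → L)
    (h : ∀ κ, (∑ j, open Classical in if α j = κ then a j else 0) =
      ∑ k, open Classical in if β k = κ then b k else 0) :
    ∃ u : J → K → ℝ≥0, (∀ j k, u j k ≠ 0 → α j = β k) ∧ (∀ j, a j ≠ 0 → ∑ k, u j k = 1) ∧
      ∀ k, ∑ j, a j * u j k = b k := by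
  classical
  set B : L → ℝ≥0 := fun κ => ∑ k, if β k = κ then b k else 0
  replace h : ∀ κ, (∑ j, if α j = κ then a j else 0) = B κ := h
  -- Each `a j` is spread over its fibre proportionally to `b`. In a fibre of zero total weight the
  -- quotient is `0`, which is consistent because `b k = 0` there.
  refine ⟨fun j k => if α j = β k then b k / B (β k) else 0, fun j k hjk => ?_, fun j hj => ?_,
    fun k => ?_⟩
  · by_contra hne
    exact hjk (by simp [hne])
  · have hpos : B (α j) ≠ 0 := by
      have h1 : a j ≤ B (α j) := by
        rw [← h (α j)]
        simpa using Finset.single_le_sum (f := fun i => if α i = α j then a i else 0)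
          (fun _ _ => zero_le) (Finset.mem_univ j)
      exact (lt_of_lt_of_le (pos_iff_ne_zero.2 hj) h1).ne'
    calc ∑ k, (if α j = β k then b k / B (β k) else 0)
        = ∑ k, (if β k = α j then b k else 0) / B (α j) := by
          refine Finset.sum_congr rfl fun k _ => ?_
          by_cases hk : α j = β k
          · simp [hk]
          · simp [hk, Ne.symm hk]
      _ = B (α j) / B (α j) := by rw [← Finset.sum_div]
      _ = 1 := div_self hpos
  · have h1 : ∑ j, a j * (if α j = β k then b k / B (β k) else 0)
        = B (β k) * (b k / B (β k)) := by
      conv_rhs => rw [← h (β k), Finset.sum_mul]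
      refine Finset.sum_congr rfl fun j _ => ?_
      split_ifs <;> simp [*]
    rw [h1]
    by_cases h0 : B (β k) = 0
    · have : b k ≤ B (β k) := by
        simpa using Finset.single_le_sum (f := fun i => if β i = β k then b i else 0)
          (fun _ _ => zero_le) (Finset.mem_univ k)
      rw [h0] at this ⊢
      simp [nonpos_iff_eq_zero.1 this]
    · field_simp

end Mixture

/-! ### Splitting mixture plans into plans between components -/

section Decomposition

variable {d K₀ K₁ : ℕ}

/-- A Gaussian mixture plan between Gaussian mixtures splits into plans between components. -/
theorem exists_plan_decomposition {π₀ : Fin K₀ → ℝ≥0} {π₁ : Fin K₁ → ℝ≥0}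
    {ν₀ : Fin K₀ → Measure (Rd d)} {ν₁ : Fin K₁ → Measure (Rd d)}
    (hν₀ : ∀ k, IsGaussian (ν₀ k)) (hν₁ : ∀ l, IsGaussian (ν₁ l))
    {γ : Measure (Rd d × Rd d)} (hγ : IsPlan (∑ k, π₀ k • ν₀ k) (∑ l, π₁ l • ν₁ l) γ)
    (hG : IsFiniteGMM γ) :
    ∃ w, IsWeightPlan π₀ π₁ w ∧ ∃ Γ : Fin K₀ → Fin K₁ → Measure (Rd d × Rd d),
      (∀ k l, w k l ≠ 0 → IsPlan (ν₀ k) (ν₁ l) (Γ k l)) ∧ γ = ∑ k, ∑ l, w k l • Γ k l := by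
  obtain ⟨J, a, g, ha, hg, rfl⟩ := hG
  obtain ⟨h1, h2⟩ := hγ
  rw [map_sum_smul _ _ measurable_fst] at h1
  rw [map_sum_smul _ _ measurable_snd] at h2
  have hg1 : ∀ j, IsGaussian ((g j).map Prod.fst) := fun j => by
    have := hg j
    exact isGaussian_map (ContinuousLinearMap.fst ℝ (Rd d) (Rd d))
  have hg2 : ∀ j, IsGaussian ((g j).map Prod.snd) := fun j => by
    have := hg j
    exact isGaussian_map (ContinuousLinearMap.snd ℝ (Rd d) (Rd d))
  -- By identifiability the first marginals of the `g j` carry the same weights as the `ν₀ k`. The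
  -- distribution `u` also handles repeated components, for which the label of `g j` is not unique.
  obtain ⟨u, hu, hu1, hua⟩ := exists_distribution a (fun j => (g j).map Prod.fst) π₀ ν₀
    (sum_weights_eq_of_mixture_eq _ hg1 _ _ hν₀ _ h1)
  obtain ⟨v, hv, hv1, hva⟩ := exists_distribution a (fun j => (g j).map Prod.snd) π₁ ν₁
    (sum_weights_eq_of_mixture_eq _ hg2 _ _ hν₁ _ h2)
  have hau : ∀ j, a j * ∑ k, u j k = a j := fun j => by
    by_cases h : a j = 0
    · simp [h]
    · simp [hu1 j h]
  have hav : ∀ j, a j * ∑ l, v j l = a j := fun j => by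
    by_cases h : a j = 0
    · simp [h]
    · simp [hv1 j h]
  -- The weight of `g j` is shared out independently in `k` and `l`. Each `Γ k l` is the normalized
  -- share; where `w k l = 0` it is the zero measure, hence the restriction to `w k l ≠ 0`.
  set w : Fin K₀ → Fin K₁ → ℝ≥0 := fun k l => ∑ j, a j * u j k * v j l with hw
  refine ⟨w, ⟨fun k => ?_, fun l => ?_⟩,
    fun k l => (w k l)⁻¹ • ∑ j, (a j * u j k * v j l) • g j, fun k l hkl => ⟨?_, ?_⟩, ?_⟩
  · rw [hw, Finset.sum_comm, ← hua k]
    refine Finset.sum_congr rfl fun j _ => ?_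
    rw [← Finset.mul_sum, mul_right_comm, hav]
  · rw [hw, Finset.sum_comm, ← hva l]
    refine Finset.sum_congr rfl fun j _ => ?_
    rw [← Finset.sum_mul, ← Finset.mul_sum, hau]
  · rw [Measure.map_smul, map_sum_smul _ _ measurable_fst]
    have : ∀ j, (a j * u j k * v j l) • (g j).map Prod.fst = (a j * u j k * v j l) • ν₀ k := by
      intro j
      by_cases h : u j k = 0
      · simp [h]
      · rw [hu j k h]
    rw [Finset.sum_congr rfl fun j _ => this j, ← Finset.sum_smul, smul_smul,
      inv_mul_cancel₀ hkl, one_smul]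
  · rw [Measure.map_smul, map_sum_smul _ _ measurable_snd]
    have : ∀ j, (a j * u j k * v j l) • (g j).map Prod.snd = (a j * u j k * v j l) • ν₁ l := by
      intro j
      by_cases h : v j l = 0
      · simp [h]
      · rw [hv j l h]
    rw [Finset.sum_congr rfl fun j _ => this j, ← Finset.sum_smul, smul_smul,
      inv_mul_cancel₀ hkl, one_smul]
  · have hterm : ∀ k l, w k l • (w k l)⁻¹ • ∑ j, (a j * u j k * v j l) • g j
        = ∑ j, (a j * u j k * v j l) • g j := by
      intro k l
      by_cases h : w k l = 0
      · have h0 := h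
        rw [hw, Finset.sum_eq_zero_iff] at h0
        rw [h, zero_smul, Finset.sum_eq_zero fun j hj => by rw [h0 j hj, zero_smul]]
      · rw [smul_smul, mul_inv_cancel₀ h, one_smul]
    simp_rw [hterm]
    rw [Finset.sum_congr rfl fun k _ => Finset.sum_comm, Finset.sum_comm]
    refine Finset.sum_congr rfl fun j _ => ?_
    simp_rw [← Finset.sum_smul, ← Finset.mul_sum]
    rw [Finset.sum_congr rfl fun k _ => mul_right_comm (a j) (u j k) (∑ l, v j l),
      hav, ← Finset.mul_sum, hau]

theorem cost_sum_smul (w : Fin K₀ → Fin K₁ → ℝ≥0)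
    (Γ : Fin K₀ → Fin K₁ → Measure (Rd d × Rd d)) :
    cost (∑ k, ∑ l, w k l • Γ k l) = ∑ k, ∑ l, (w k l : ℝ≥0∞) * cost (Γ k l) := by
  simp only [cost, lintegral_finsetSum_measure, lintegral_smul_measure]
  rfl

theorem isPlan_sum_smul {π₀ : Fin K₀ → ℝ≥0} {π₁ : Fin K₁ → ℝ≥0}
    {ν₀ : Fin K₀ → Measure (Rd d)} {ν₁ : Fin K₁ → Measure (Rd d)} {w : Fin K₀ → Fin K₁ → ℝ≥0}
    (hw : IsWeightPlan π₀ π₁ w) {Γ : Fin K₀ → Fin K₁ → Measure (Rd d × Rd d)}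
    (hΓ : ∀ k l, IsPlan (ν₀ k) (ν₁ l) (Γ k l)) :
    IsPlan (∑ k, π₀ k • ν₀ k) (∑ l, π₁ l • ν₁ l) (∑ k, ∑ l, w k l • Γ k l) := by
  constructor
  · simp_rw [map_sum_sum_smul _ _ measurable_fst, (hΓ _ _).1, ← Finset.sum_smul, hw.1]
  · rw [map_sum_sum_smul _ _ measurable_snd, Finset.sum_comm]
    simp_rw [(hΓ _ _).2, ← Finset.sum_smul, hw.2]

end Decomposition

/-! ### Existence of a Gaussian optimal plan between Gaussian measures -/

section Existence

/-- The projection of `ℝ^ι` given by a relabelling `f : κ → ι` of the coordinates. -/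
noncomputable def coordMap {ι κ : Type*} [Fintype ι] [Fintype κ] (f : κ → ι) :
    EuclideanSpace ℝ ι →L[ℝ] EuclideanSpace ℝ κ :=
  LinearMap.toContinuousLinearMap
    { toFun := fun x => WithLp.toLp 2 fun j => x (f j)
      map_add' := fun x y => by ext; simp
      map_smul' := fun c x => by ext; simp }

@[simp]
theorem coordMap_apply {ι κ : Type*} [Fintype ι] [Fintype κ] (f : κ → ι)
    (x : EuclideanSpace ℝ ι) (j : κ) : coordMap f x j = x (f j) := rfl

theorem map_coordMap_multivariateGaussian {ι κ : Type*} [Fintype ι] [Fintype κ] [DecidableEq ι]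
    [DecidableEq κ] (f : κ → ι) (m : EuclideanSpace ℝ ι) {M : Matrix ι ι ℝ} (hM : M.PosSemidef) :
    (multivariateGaussian m M).map (coordMap f) =
      multivariateGaussian (coordMap f m) (M.submatrix f f) := by
  apply IsGaussian.ext
  · simp only [id_eq, integral_id_multivariateGaussian]
    rw [ContinuousLinearMap.integral_id_map, integral_id_multivariateGaussian]
    exact IsGaussian.integrable_id
  rw [← ContinuousLinearMap.toBilinForm_inj]
  refine LinearMap.BilinForm.ext_basis (EuclideanSpace.basisFun κ ℝ).toBasis fun i j => ?_
  rw [ContinuousLinearMap.toBilinForm_apply, ContinuousLinearMap.toBilinForm_apply,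
    covarianceBilin_apply_eq_cov, covariance_map]
  · have (i : κ) : (fun u => inner ℝ ((EuclideanSpace.basisFun κ ℝ).toBasis i) u) ∘
        coordMap f = fun u => u (f i) := by ext; simp [PiLp.inner_apply]
    simp_rw [this, covariance_eval_multivariateGaussian hM,
      covarianceBilin_multivariateGaussian (hM.submatrix _)]
    simp
  any_goals exact Measurable.aestronglyMeasurable (by fun_prop)
  · fun_prop
  · exact IsGaussian.memLp_two_id

variable {d : ℕ}

theorem cost_eq_ofReal_integral {γ : Measure (Rd d × Rd d)}
    (h : Integrable (fun p : Rd d × Rd d => ‖p.1 - p.2‖ ^ 2) γ) :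
    cost γ = ENNReal.ofReal (∫ p, ‖p.1 - p.2‖ ^ 2 ∂γ) := by
  rw [cost, ofReal_integral_eq_lintegral_ofReal h (ae_of_all _ fun _ => by positivity)]
  refine lintegral_congr fun p => ?_
  rw [ENNReal.ofReal_pow (norm_nonneg _), ofReal_norm]

/-- The `i`-th coordinate of a point of `ℝ^d × ℝ^d`. -/
def pairCoord (i : Fin d ⊕ Fin d) (p : Rd d × Rd d) : ℝ := Sum.elim (p.1 ·) (p.2 ·) i

theorem measurable_pairCoord (i : Fin d ⊕ Fin d) : Measurable (pairCoord i) := by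
  rcases i with i | i
  · exact (by fun_prop : Measurable fun p : Rd d × Rd d => p.1 i)
  · exact (by fun_prop : Measurable fun p : Rd d × Rd d => p.2 i)

/-- The covariance matrix of a measure on `ℝ^d × ℝ^d`. -/
noncomputable def pairCov (γ : Measure (Rd d × Rd d)) : Matrix (Fin d ⊕ Fin d) (Fin d ⊕ Fin d) ℝ :=
  Matrix.of fun i j => cov[pairCoord i, pairCoord j; γ]

/-- The part of the transport cost that depends on the covariance matrix. -/
def covCost (M : Matrix (Fin d ⊕ Fin d) (Fin d ⊕ Fin d) ℝ) : ℝ :=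
  ∑ i, (M (.inl i) (.inl i) - 2 * M (.inl i) (.inr i) + M (.inr i) (.inr i))

/-- The covariance matrices of the couplings of measures with covariance matrices `S₀`, `S₁`. -/
def couplingCov (S₀ S₁ : Matrix (Fin d) (Fin d) ℝ) :
    Set (Matrix (Fin d ⊕ Fin d) (Fin d ⊕ Fin d) ℝ) :=
  {M | M.PosSemidef ∧ M.submatrix Sum.inl Sum.inl = S₀ ∧ M.submatrix Sum.inr Sum.inr = S₁}

/-- The quadratic form at `x` is the variance of the linear combination of coordinates with
coefficients `x`. -/
theorem posSemidef_pairCov {γ : Measure (Rd d × Rd d)} [IsProbabilityMeasure γ]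
    (h : ∀ i, MemLp (pairCoord i) 2 γ) : (pairCov γ).PosSemidef := by
  refine Matrix.PosSemidef.of_dotProduct_mulVec_nonneg ?_ fun x => ?_
  · ext i j
    simp [pairCov, covariance_comm]
  · have h1 : Var[∑ i, x i • pairCoord i; γ] = star x ⬝ᵥ (pairCov γ).mulVec x := by
      rw [← covariance_self, covariance_sum_sum]
      · simp only [covariance_smul_left, covariance_smul_right, dotProduct, Matrix.mulVec,
          pairCov, Matrix.of_apply, Finset.mul_sum, star_trivial]
        refine Finset.sum_congr rfl fun i _ => Finset.sum_congr rfl fun j _ => by ring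
      · exact fun i => (h i).const_smul _
      · exact fun i => (h i).const_smul _
      · exact Finset.aemeasurable_sum _ fun i _ => ((h i).const_smul _).aemeasurable
    rw [← h1]
    exact variance_nonneg _ _

/-- In each coordinate the second moment of the difference is its variance plus the square of its
mean. Thus only first and second moments of the plan enter the cost. -/
theorem cost_eq_covCost {γ : Measure (Rd d × Rd d)} [IsProbabilityMeasure γ]
    (h : ∀ i, MemLp (pairCoord i) 2 γ) :
    cost γ = ENNReal.ofReal (covCost (pairCov γ) +
      ∑ i, (γ[pairCoord (.inl i)] - γ[pairCoord (.inr i)]) ^ 2) := by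
  have hsub : ∀ i : Fin d, MemLp (pairCoord (.inl i) - pairCoord (.inr i)) 2 γ :=
    fun i => (h _).sub (h _)
  have heq : (fun p : Rd d × Rd d => ‖p.1 - p.2‖ ^ 2) =
      fun p => ∑ i, ((pairCoord (.inl i) - pairCoord (.inr i)) p) ^ 2 := by
    funext p
    rw [EuclideanSpace.real_norm_sq_eq]
    rfl
  have hint : Integrable (fun p : Rd d × Rd d => ‖p.1 - p.2‖ ^ 2) γ := by
    rw [heq]
    exact integrable_finsetSum _ fun i _ => (hsub i).integrable_sq
  rw [cost_eq_ofReal_integral hint, heq, integral_finsetSum _ fun i _ => (hsub i).integrable_sq,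
    covCost, ← Finset.sum_add_distrib]
  congr 1
  refine Finset.sum_congr rfl fun i _ => ?_
  have h1 := variance_eq_sub (hsub i)
  rw [variance_sub (h _) (h _)] at h1
  have h2 : γ[pairCoord (.inl i) - pairCoord (.inr i)]
      = γ[pairCoord (.inl i)] - γ[pairCoord (.inr i)] :=
    integral_sub ((h _).integrable one_le_two) ((h _).integrable one_le_two)
  rw [h2] at h1
  simp only [pairCov, Matrix.of_apply]
  rw [covariance_self (h _).aemeasurable, covariance_self (h _).aemeasurable, h1]
  simp

/-- The quadratic form is tested on `e_i + e_j` and `e_i - e_j`. -/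
theorem abs_apply_le_of_posSemidef {ι : Type*} [Fintype ι] {M : Matrix ι ι ℝ} (hM : M.PosSemidef)
    (i j : ι) : |M i j| ≤ (M i i + M j j) / 2 := by
  classical
  have hsymm : M j i = M i j := by simpa using hM.isHermitian.apply i j
  have hp := hM.dotProduct_mulVec_nonneg (Pi.single i 1 + Pi.single j 1)
  have hm := hM.dotProduct_mulVec_nonneg (Pi.single i 1 - Pi.single j 1)
  simp [Matrix.mulVec_add, Matrix.mulVec_sub, hsymm] at hp hm
  rw [abs_le]
  constructor <;> linarith

/-- The diagonal of a coupling covariance is prescribed by `S₀` and `S₁`, and positivity bounds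
every other entry by the diagonal. -/
theorem isCompact_couplingCov (S₀ S₁ : Matrix (Fin d) (Fin d) ℝ) :
    IsCompact (couplingCov S₀ S₁) := by
  have hclosed : IsClosed (couplingCov S₀ S₁) := by
    have h1 : IsClosed {M : Matrix (Fin d ⊕ Fin d) (Fin d ⊕ Fin d) ℝ | M.PosSemidef} := by
      simp only [Matrix.posSemidef_iff_dotProduct_mulVec, Matrix.IsHermitian, ofPred_and,
        ofPred_forall]
      refine (isClosed_eq (by fun_prop) (by fun_prop)).inter (isClosed_iInter fun x => ?_)
      exact isClosed_le (by fun_prop) (by fun_prop)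
    refine h1.inter (IsClosed.inter ?_ ?_)
    · exact isClosed_eq (by fun_prop) continuous_const
    · exact isClosed_eq (by fun_prop) continuous_const
  set s : Fin d ⊕ Fin d → ℝ := Sum.elim S₀.diag S₁.diag
  have hK : IsCompact (Set.pi Set.univ fun i => Set.pi Set.univ fun j =>
      Icc (-((s i + s j) / 2)) ((s i + s j) / 2) :
      Set (Matrix (Fin d ⊕ Fin d) (Fin d ⊕ Fin d) ℝ)) :=
    isCompact_univ_pi fun i => isCompact_univ_pi fun j => isCompact_Icc
  refine hK.of_isClosed_subset hclosed ?_
  rintro M ⟨hM, h0, h1⟩ i - j -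
  have hdiag : ∀ i, M i i = s i := by
    rintro (i | i)
    · exact congrFun (congrFun h0 i) i
    · exact congrFun (congrFun h1 i) i
  have h := abs_apply_le_of_posSemidef hM i j
  rw [hdiag, hdiag] at h
  exact abs_le.1 h

theorem IsPlan.isProbabilityMeasure {μ ν : Measure (Rd d)} [IsProbabilityMeasure μ]
    {γ : Measure (Rd d × Rd d)} (h : IsPlan μ ν γ) : IsProbabilityMeasure γ := by
  have : IsProbabilityMeasure (γ.map Prod.fst) := h.1 ▸ inferInstance
  exact Measure.isProbabilityMeasure_of_map Prod.fst

variable (m₀ m₁ : Rd d) {S₀ S₁ : Matrix (Fin d) (Fin d) ℝ}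

theorem IsPlan.memLp_fst {μ ν : Measure (Rd d)} [IsGaussian μ] {γ : Measure (Rd d × Rd d)}
    (h : IsPlan μ ν γ) : MemLp Prod.fst 2 γ := by
  have h1 : MemLp id 2 (γ.map Prod.fst) := h.1 ▸ IsGaussian.memLp_two_id
  exact (memLp_map_measure_iff aestronglyMeasurable_id measurable_fst.aemeasurable).1 h1

theorem IsPlan.memLp_snd {μ ν : Measure (Rd d)} [IsGaussian ν] {γ : Measure (Rd d × Rd d)}
    (h : IsPlan μ ν γ) : MemLp Prod.snd 2 γ := by
  have h1 : MemLp id 2 (γ.map Prod.snd) := h.2 ▸ IsGaussian.memLp_two_id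
  exact (memLp_map_measure_iff aestronglyMeasurable_id measurable_snd.aemeasurable).1 h1

theorem IsPlan.memLp_pairCoord {μ ν : Measure (Rd d)} [IsGaussian μ] [IsGaussian ν]
    {γ : Measure (Rd d × Rd d)} (h : IsPlan μ ν γ) (i : Fin d ⊕ Fin d) :
    MemLp (pairCoord i) 2 γ := by
  rcases i with i | i
  · exact (EuclideanSpace.proj (𝕜 := ℝ) i).comp_memLp' h.memLp_fst
  · exact (EuclideanSpace.proj (𝕜 := ℝ) i).comp_memLp' h.memLp_snd

theorem integral_eval_multivariateGaussian (m : Rd d) (S : Matrix (Fin d) (Fin d) ℝ) (i : Fin d) :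
    ∫ x, x i ∂(multivariateGaussian m S) = m i := by
  have := (EuclideanSpace.proj (𝕜 := ℝ) i).integral_comp_id_comm
    (IsGaussian.integrable_id (μ := multivariateGaussian m S))
  simpa using this

variable {m₀ m₁}

theorem IsPlan.pairCov_mem (hS₀ : S₀.PosSemidef) (hS₁ : S₁.PosSemidef)
    {γ : Measure (Rd d × Rd d)}
    (h : IsPlan (multivariateGaussian m₀ S₀) (multivariateGaussian m₁ S₁) γ) :
    pairCov γ ∈ couplingCov S₀ S₁ := by
  have := h.isProbabilityMeasure
  refine ⟨posSemidef_pairCov h.memLp_pairCoord, ?_, ?_⟩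
  · ext i j
    rw [← covariance_eval_multivariateGaussian (μ := m₀) hS₀ i j, ← h.1,
      covariance_map (by fun_prop) (by fun_prop) (by fun_prop)]
    rfl
  · ext i j
    rw [← covariance_eval_multivariateGaussian (μ := m₁) hS₁ i j, ← h.2,
      covariance_map (by fun_prop) (by fun_prop) (by fun_prop)]
    rfl

theorem IsPlan.cost_eq {γ : Measure (Rd d × Rd d)}
    (h : IsPlan (multivariateGaussian m₀ S₀) (multivariateGaussian m₁ S₁) γ) :
    cost γ = ENNReal.ofReal (covCost (pairCov γ) + ∑ i, (m₀ i - m₁ i) ^ 2) := by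
  have := h.isProbabilityMeasure
  have h0 : ∀ i, γ[pairCoord (.inl i)] = m₀ i := fun i => by
    rw [← integral_eval_multivariateGaussian m₀ S₀ i, ← h.1, integral_map (by fun_prop) (by fun_prop)]
    rfl
  have h1 : ∀ i, γ[pairCoord (.inr i)] = m₁ i := fun i => by
    rw [← integral_eval_multivariateGaussian m₁ S₁ i, ← h.2, integral_map (by fun_prop) (by fun_prop)]
    rfl
  rw [cost_eq_covCost h.memLp_pairCoord]
  simp only [h0, h1]

/-- The Gaussian measure on `ℝ^d × ℝ^d` with means `m₀`, `m₁` and covariance matrix `M`. -/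
noncomputable def pairGaussian (m₀ m₁ : Rd d) (M : Matrix (Fin d ⊕ Fin d) (Fin d ⊕ Fin d) ℝ) :
    Measure (Rd d × Rd d) :=
  (multivariateGaussian (WithLp.toLp 2 (Sum.elim m₀ m₁)) M).map
    ((coordMap Sum.inl).prod (coordMap Sum.inr))

theorem isGaussian_pairGaussian (m₀ m₁ : Rd d) (M : Matrix (Fin d ⊕ Fin d) (Fin d ⊕ Fin d) ℝ) :
    IsGaussian (pairGaussian m₀ m₁ M) :=
  isGaussian_map _

theorem isPlan_pairGaussian (m₀ m₁ : Rd d) {M : Matrix (Fin d ⊕ Fin d) (Fin d ⊕ Fin d) ℝ}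
    (hM : M ∈ couplingCov S₀ S₁) :
    IsPlan (multivariateGaussian m₀ S₀) (multivariateGaussian m₁ S₁) (pairGaussian m₀ m₁ M) := by
  obtain ⟨hM, rfl, rfl⟩ := hM
  constructor
  · rw [pairGaussian, Measure.map_map (by fun_prop) (by fun_prop)]
    exact map_coordMap_multivariateGaussian Sum.inl _ hM
  · rw [pairGaussian, Measure.map_map (by fun_prop) (by fun_prop)]
    exact map_coordMap_multivariateGaussian Sum.inr _ hM

theorem pairCov_pairGaussian (m₀ m₁ : Rd d) {M : Matrix (Fin d ⊕ Fin d) (Fin d ⊕ Fin d) ℝ}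
    (hM : M.PosSemidef) : pairCov (pairGaussian m₀ m₁ M) = M := by
  ext i j
  rw [pairCov, Matrix.of_apply, pairGaussian,
    covariance_map (measurable_pairCoord i).aestronglyMeasurable
      (measurable_pairCoord j).aestronglyMeasurable (by fun_prop)]
  rw [← covariance_eval_multivariateGaussian (μ := WithLp.toLp 2 (Sum.elim m₀ m₁)) hM i j]
  rcases i with i | i <;> rcases j with j | j <;> rfl

/-- Minimizing the continuous `covCost` over the compact set of coupling covariances gives `M`. The
Gaussian plan with covariance `M` then beats every plan, Gaussian or not, because any plan has its
covariance in the same set. -/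
theorem exists_isGaussian_isW2Optimal (m₀ m₁ : Rd d) (hS₀ : S₀.PosSemidef) (hS₁ : S₁.PosSemidef) :
    ∃ g, IsGaussian g ∧
      IsW2Optimal (multivariateGaussian m₀ S₀) (multivariateGaussian m₁ S₁) g := by
  have hne : (couplingCov S₀ S₁).Nonempty :=
    ⟨_, IsPlan.pairCov_mem (m₀ := 0) (m₁ := 0) hS₀ hS₁
      (γ := (multivariateGaussian 0 S₀).prod (multivariateGaussian 0 S₁))
      ⟨by simp, by simp⟩⟩
  have hcont : Continuous (covCost (d := d)) := by
    unfold covCost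
    fun_prop
  obtain ⟨M, hM, hmin⟩ := (isCompact_couplingCov S₀ S₁).exists_isMinOn hne hcont.continuousOn
  have hplan := isPlan_pairGaussian m₀ m₁ hM
  refine ⟨pairGaussian m₀ m₁ M, isGaussian_pairGaussian _ _ _, hplan,
    le_antisymm (le_iInf fun γ => ?_) (iInf_le_of_le ⟨_, hplan⟩ le_rfl)⟩
  rw [hplan.cost_eq, γ.2.cost_eq, pairCov_pairGaussian m₀ m₁ hM.1]
  gcongr
  exact hmin (γ.2.pairCov_mem hS₀ hS₁)

/-- Finiteness is what permits strict comparison of sums in `ℝ≥0∞` and the passage to `ℝ≥0` costs in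
the discrete problem. -/
theorem W2sq_multivariateGaussian_ne_top (m₀ m₁ : Rd d) (hS₀ : S₀.PosSemidef)
    (hS₁ : S₁.PosSemidef) :
    W2sq (multivariateGaussian m₀ S₀) (multivariateGaussian m₁ S₁) ≠ ∞ := by
  obtain ⟨g, -, hg, hc⟩ := exists_isGaussian_isW2Optimal m₀ m₁ hS₀ hS₁
  rw [← hc, hg.cost_eq]
  exact ENNReal.ofReal_ne_top

end Existence

/-! ### The optimal map out of a nondegenerate Gaussian measure -/

section OptimalMap

theorem integrable_inner_of_memLp_two {α E : Type*} [MeasurableSpace α] {μ : Measure α}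
    [NormedAddCommGroup E] [InnerProductSpace ℝ E] {f g : α → E} (hf : MemLp f 2 μ)
    (hg : MemLp g 2 μ) : Integrable (fun x => inner ℝ (f x) (g x)) μ := by
  refine (hf.norm.integrable_mul hg.norm).mono' (hf.1.inner hg.1) (ae_of_all _ fun x => ?_)
  exact norm_inner_le_norm _ _

variable {d : ℕ}

theorem inner_toEuclideanCLM_left (M : Matrix (Fin d) (Fin d) ℝ) (x y : Rd d) :
    inner ℝ (Matrix.toEuclideanCLM (𝕜 := ℝ) M x) y =
      inner ℝ x (Matrix.toEuclideanCLM (𝕜 := ℝ) M.transpose y) := by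
  rw [← ContinuousLinearMap.adjoint_inner_right]
  congr 1
  have := map_star (Matrix.toEuclideanCLM (n := Fin d) (𝕜 := ℝ)) M
  rw [ContinuousLinearMap.star_eq_adjoint] at this
  rw [← this]
  rfl

theorem toEuclideanCLM_mul_apply (M N : Matrix (Fin d) (Fin d) ℝ) (x : Rd d) :
    Matrix.toEuclideanCLM (𝕜 := ℝ) (M * N) x =
      Matrix.toEuclideanCLM (𝕜 := ℝ) M (Matrix.toEuclideanCLM (𝕜 := ℝ) N x) := by
  rw [map_mul]
  rfl

/-- Every positive semidefinite matrix has a symmetric generalized inverse. -/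
theorem exists_generalizedInverse {A : Matrix (Fin d) (Fin d) ℝ} (hA : A.PosSemidef) :
    ∃ G : Matrix (Fin d) (Fin d) ℝ, G.transpose = G ∧ A * G * A = A := by
  have hsa : IsSelfAdjoint A := hA.isHermitian
  refine ⟨cfc (fun x : ℝ => x⁻¹) A, ?_, ?_⟩
  · have : IsSelfAdjoint (cfc (fun x : ℝ => x⁻¹) A) := cfc_predicate _ _
    simpa using (show (cfc (fun x : ℝ => x⁻¹) A).IsHermitian from this).eq
  -- The spectrum is finite, so every function is continuous on it; with `0⁻¹ = 0` the identity `x *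
  -- x⁻¹ * x = x` also holds at the eigenvalue `0`.
  · have hcont : ∀ f : ℝ → ℝ, ContinuousOn f (spectrum ℝ A) := fun f =>
      (Matrix.finite_real_spectrum (A := A)).continuousOn f
    calc A * cfc (fun x : ℝ => x⁻¹) A * A
        = cfc (fun x : ℝ => x) A * cfc (fun x : ℝ => x⁻¹) A * cfc (fun x : ℝ => x) A := by
          rw [cfc_id' ℝ A]
      _ = cfc (fun x : ℝ => x * x⁻¹ * x) A := by
          rw [← cfc_mul _ _ A (hcont _) (hcont _), ← cfc_mul _ _ A (hcont _) (hcont _)]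
      _ = cfc (fun x : ℝ => x) A := by simp only [mul_inv_mul_cancel]
      _ = A := cfc_id' ℝ A

theorem integral_inner_multivariateGaussian (m : Rd d) {S : Matrix (Fin d) (Fin d) ℝ}
    (hS : S.PosSemidef) (M : Matrix (Fin d) (Fin d) ℝ) :
    ∫ x, inner ℝ (x - m) (Matrix.toEuclideanCLM (𝕜 := ℝ) M (x - m)) ∂(multivariateGaussian m S)
      = (M * S).trace := by
  have hc : ∀ i j, Integrable (fun x : Rd d => M i j * ((x i - m i) * (x j - m j)))
      (multivariateGaussian m S) := by
    intro i j
    have h : ∀ i, MemLp (fun x : Rd d => x i - m i) 2 (multivariateGaussian m S) := fun i =>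
      ((EuclideanSpace.proj (𝕜 := ℝ) i).comp_memLp' IsGaussian.memLp_two_id).sub (memLp_const _)
    exact ((h i).integrable_mul (h j)).const_mul _
  have heq : ∀ x : Rd d, inner ℝ (x - m) (Matrix.toEuclideanCLM (𝕜 := ℝ) M (x - m)) =
      ∑ i, ∑ j, M i j * ((x i - m i) * (x j - m j)) := by
    intro x
    rw [Matrix.inner_toEuclideanCLM]
    simp only [dotProduct, Matrix.mulVec, Finset.mul_sum, PiLp.sub_apply]
    refine Finset.sum_congr rfl fun i _ => Finset.sum_congr rfl fun j _ => by ring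
  simp_rw [heq]
  rw [integral_finsetSum _ fun i _ => integrable_finsetSum _ fun j _ => hc i j]
  refine Finset.sum_congr rfl fun i _ => ?_
  rw [integral_finsetSum _ fun j _ => hc i j, Matrix.diag_apply, Matrix.mul_apply]
  refine Finset.sum_congr rfl fun j _ => ?_
  rw [integral_const_mul, ← covariance_eval_multivariateGaussian (μ := m) hS j i, covariance_comm,
    covariance]
  simp only [integral_eval_multivariateGaussian]

variable {m₀ m₁ : Rd d} {S₀ S₁ A G B : Matrix (Fin d) (Fin d) ℝ} {γ : Measure (Rd d × Rd d)}

/-- Since `S₁ = A * S₀ * A`, the centred second marginal is concentrated on the range of `A`, where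
`A * G` acts as the identity: with `N = 1 - A * G`, the mean of `‖N (y - m₁)‖²` is the trace of `Nᵀ
* N * S₁ = 0`. -/
theorem ae_eq_of_isPlan_of_mul_mul_eq (hS₁ : S₁.PosSemidef)
    (hAS : A * S₀ * A = S₁) (hAG : A * G * A = A)
    (h : IsPlan (multivariateGaussian m₀ S₀) (multivariateGaussian m₁ S₁) γ) :
    ∀ᵐ p ∂γ, Matrix.toEuclideanCLM (𝕜 := ℝ) (A * G) (p.2 - m₁) = p.2 - m₁ := by
  have hae : ∀ᵐ y ∂(multivariateGaussian m₁ S₁),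
      Matrix.toEuclideanCLM (𝕜 := ℝ) (A * G) (y - m₁) = y - m₁ := by
    set N : Matrix (Fin d) (Fin d) ℝ := 1 - A * G with hN
    have hNA : N * S₁ = 0 := by
      rw [hN, ← hAS, sub_mul, one_mul, ← mul_assoc (A * G), ← mul_assoc (A * G), hAG, sub_self]
    have hsq : ∀ y : Rd d, ‖Matrix.toEuclideanCLM (𝕜 := ℝ) N (y - m₁)‖ ^ 2 =
        inner ℝ (y - m₁) (Matrix.toEuclideanCLM (𝕜 := ℝ) (N.transpose * N) (y - m₁)) := by
      intro y
      rw [← real_inner_self_eq_norm_sq, inner_toEuclideanCLM_left, toEuclideanCLM_mul_apply]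
    have hint : ∫ y, ‖Matrix.toEuclideanCLM (𝕜 := ℝ) N (y - m₁)‖ ^ 2
        ∂(multivariateGaussian m₁ S₁) = 0 := by
      simp_rw [hsq]
      rw [integral_inner_multivariateGaussian m₁ hS₁, mul_assoc, hNA]
      simp
    have hmem : MemLp (fun y : Rd d => Matrix.toEuclideanCLM (𝕜 := ℝ) N (y - m₁)) 2
        (multivariateGaussian m₁ S₁) :=
      (Matrix.toEuclideanCLM (𝕜 := ℝ) N).comp_memLp'
        (IsGaussian.memLp_two_id.sub (memLp_const m₁))
    rw [integral_eq_zero_iff_of_nonneg (fun _ => by positivity) hmem.norm.integrable_sq] at hint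
    filter_upwards [hint] with y hy
    have h0 : Matrix.toEuclideanCLM (𝕜 := ℝ) N (y - m₁) = 0 := by simpa using hy
    rw [hN, map_sub Matrix.toEuclideanCLM, map_one] at h0
    exact (sub_eq_zero.1 h0).symm
  rw [← h.2] at hae
  exact ae_of_ae_map measurable_snd.aemeasurable hae

/-- Completing the square: the cross term `-2 ⟨x, y⟩` is absorbed into `‖B (x - G y)‖²`, and what
remains is linear or depends on `x` or `y` alone. Its integral is therefore fixed by the marginals.
-/
theorem norm_add_sub_sq_eq (hB : B.transpose = B) (hBA : B * B = A) (hG : G.transpose = G)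
    (c x : Rd d) {y : Rd d} (hy : Matrix.toEuclideanCLM (𝕜 := ℝ) (A * G) y = y) :
    ‖c + (x - y)‖ ^ 2 = ‖c‖ ^ 2 + 2 * inner ℝ c (x - y) +
      inner ℝ x (Matrix.toEuclideanCLM (𝕜 := ℝ) (1 - A) x) +
      inner ℝ y (Matrix.toEuclideanCLM (𝕜 := ℝ) (1 - G * A * G) y) +
      ‖Matrix.toEuclideanCLM (𝕜 := ℝ) B (x - Matrix.toEuclideanCLM (𝕜 := ℝ) G y)‖ ^ 2 := by
  have hAt : A.transpose = A := by rw [← hBA, Matrix.transpose_mul, hB]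
  have h1 : inner ℝ (Matrix.toEuclideanCLM (𝕜 := ℝ) G y)
      (Matrix.toEuclideanCLM (𝕜 := ℝ) A x) = inner ℝ x y := by
    rw [real_inner_comm, inner_toEuclideanCLM_left, hAt, ← toEuclideanCLM_mul_apply, hy]
  have h2 : ‖Matrix.toEuclideanCLM (𝕜 := ℝ) B (x - Matrix.toEuclideanCLM (𝕜 := ℝ) G y)‖ ^ 2 =
      inner ℝ x (Matrix.toEuclideanCLM (𝕜 := ℝ) A x) - 2 * inner ℝ x y
        + inner ℝ y (Matrix.toEuclideanCLM (𝕜 := ℝ) (G * A * G) y) := by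
    rw [← real_inner_self_eq_norm_sq, inner_toEuclideanCLM_left, hB, ← toEuclideanCLM_mul_apply,
      hBA, map_sub, inner_sub_left, inner_sub_right, inner_sub_right, h1,
      ← toEuclideanCLM_mul_apply, hy, inner_toEuclideanCLM_left, hG, mul_assoc,
      toEuclideanCLM_mul_apply, hy]
    ring
  rw [norm_add_sq_real, norm_sub_sq_real, h2]
  simp only [map_sub, map_one, sub_apply, inner_sub_right,
    one_apply_eq_self, real_inner_self_eq_norm_sq]
  ring

theorem integrable_and_integral_const_add {α : Type*} [MeasurableSpace α] {μ : Measure α}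
    [IsProbabilityMeasure μ] (c : ℝ) {f₁ f₂ f₃ f₄ : α → ℝ} (h₁ : Integrable f₁ μ)
    (h₂ : Integrable f₂ μ) (h₃ : Integrable f₃ μ) (h₄ : Integrable f₄ μ) :
    Integrable (fun x => c + f₁ x + f₂ x + f₃ x + f₄ x) μ ∧
      ∫ x, c + f₁ x + f₂ x + f₃ x + f₄ x ∂μ =
        c + ∫ x, f₁ x ∂μ + ∫ x, f₂ x ∂μ + ∫ x, f₃ x ∂μ + ∫ x, f₄ x ∂μ := by
  have h0 : Integrable (fun _ : α => c) μ := integrable_const c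
  have h01 : Integrable (fun x => c + f₁ x) μ := h0.add h₁
  have h012 : Integrable (fun x => c + f₁ x + f₂ x) μ := h01.add h₂
  have h0123 : Integrable (fun x => c + f₁ x + f₂ x + f₃ x) μ := h012.add h₃
  refine ⟨h0123.add h₄, ?_⟩
  rw [integral_add h0123 h₄, integral_add h012 h₃, integral_add h01 h₂, integral_add h0 h₁]
  simp

/-- The transport cost of a plan between Gaussian measures exceeds an explicit constant by the
integral of a nonnegative defect. -/
theorem IsPlan.integral_eq_add_integral_defect (hS₀ : S₀.PosSemidef) (hS₁ : S₁.PosSemidef)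
    (hB : B.transpose = B) (hBA : B * B = A) (hAS : A * S₀ * A = S₁)
    (hG : G.transpose = G) (hAG : A * G * A = A)
    (h : IsPlan (multivariateGaussian m₀ S₀) (multivariateGaussian m₁ S₁) γ) :
    Integrable (fun p : Rd d × Rd d => ‖Matrix.toEuclideanCLM (𝕜 := ℝ) B
        (p.1 - m₀ - Matrix.toEuclideanCLM (𝕜 := ℝ) G (p.2 - m₁))‖ ^ 2) γ ∧
      Integrable (fun p : Rd d × Rd d => ‖p.1 - p.2‖ ^ 2) γ ∧
      ∫ p, ‖p.1 - p.2‖ ^ 2 ∂γ =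
        ‖m₀ - m₁‖ ^ 2 + S₀.trace + S₁.trace - 2 * (A * S₀).trace +
        ∫ p, ‖Matrix.toEuclideanCLM (𝕜 := ℝ) B
          (p.1 - m₀ - Matrix.toEuclideanCLM (𝕜 := ℝ) G (p.2 - m₁))‖ ^ 2 ∂γ := by
  have := h.isProbabilityMeasure
  have hX : MemLp (fun p : Rd d × Rd d => p.1 - m₀) 2 γ := h.memLp_fst.sub (memLp_const m₀)
  have hY : MemLp (fun p : Rd d × Rd d => p.2 - m₁) 2 γ := h.memLp_snd.sub (memLp_const m₁)
  set q : Rd d × Rd d → ℝ := fun p => ‖Matrix.toEuclideanCLM (𝕜 := ℝ) B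
        (p.1 - m₀ - Matrix.toEuclideanCLM (𝕜 := ℝ) G (p.2 - m₁))‖ ^ 2 with hq
  have hqint : Integrable q γ :=
    ((Matrix.toEuclideanCLM (𝕜 := ℝ) B).comp_memLp' (hX.sub
      ((Matrix.toEuclideanCLM (𝕜 := ℝ) G).comp_memLp' hY))).norm.integrable_sq
  refine ⟨hqint, ?_⟩
  have hxint : ∀ M : Matrix (Fin d) (Fin d) ℝ, Integrable (fun p : Rd d × Rd d =>
      inner ℝ (p.1 - m₀) (Matrix.toEuclideanCLM (𝕜 := ℝ) M (p.1 - m₀))) γ := fun M =>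
    integrable_inner_of_memLp_two hX ((Matrix.toEuclideanCLM (𝕜 := ℝ) M).comp_memLp' hX)
  have hyint : ∀ M : Matrix (Fin d) (Fin d) ℝ, Integrable (fun p : Rd d × Rd d =>
      inner ℝ (p.2 - m₁) (Matrix.toEuclideanCLM (𝕜 := ℝ) M (p.2 - m₁))) γ := fun M =>
    integrable_inner_of_memLp_two hY ((Matrix.toEuclideanCLM (𝕜 := ℝ) M).comp_memLp' hY)
  have hxval : ∀ M : Matrix (Fin d) (Fin d) ℝ, ∫ p, inner ℝ (p.1 - m₀)
      (Matrix.toEuclideanCLM (𝕜 := ℝ) M (p.1 - m₀)) ∂γ = (M * S₀).trace := fun M => by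
    rw [← integral_inner_multivariateGaussian m₀ hS₀ M, ← h.1,
      integral_map (by fun_prop) (by fun_prop)]
  have hyval : ∀ M : Matrix (Fin d) (Fin d) ℝ, ∫ p, inner ℝ (p.2 - m₁)
      (Matrix.toEuclideanCLM (𝕜 := ℝ) M (p.2 - m₁)) ∂γ = (M * S₁).trace := fun M => by
    rw [← integral_inner_multivariateGaussian m₁ hS₁ M, ← h.2,
      integral_map (by fun_prop) (by fun_prop)]
  have hlint : Integrable (fun p : Rd d × Rd d =>
      inner ℝ (m₀ - m₁) ((p.1 - m₀) - (p.2 - m₁))) γ :=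
    ((hX.sub hY).integrable one_le_two).const_inner _
  have hx0 : ∫ p : Rd d × Rd d, (p.1 - m₀) ∂γ = 0 := by
    have h1 : ∫ p : Rd d × Rd d, p.1 ∂γ = m₀ := by
      conv_rhs => rw [← integral_id_multivariateGaussian (μ := m₀) (S := S₀), ← h.1]
      rw [integral_map (by fun_prop) (by fun_prop)]
    rw [integral_sub (h.memLp_fst.integrable one_le_two) (integrable_const _), h1]
    simp
  have hy0 : ∫ p : Rd d × Rd d, (p.2 - m₁) ∂γ = 0 := by
    have h1 : ∫ p : Rd d × Rd d, p.2 ∂γ = m₁ := by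
      conv_rhs => rw [← integral_id_multivariateGaussian (μ := m₁) (S := S₁), ← h.2]
      rw [integral_map (by fun_prop) (by fun_prop)]
    rw [integral_sub (h.memLp_snd.integrable one_le_two) (integrable_const _), h1]
    simp
  have hlval : ∫ p : Rd d × Rd d, inner ℝ (m₀ - m₁) ((p.1 - m₀) - (p.2 - m₁)) ∂γ = 0 := by
    have hXY : Integrable (fun p : Rd d × Rd d => (p.1 - m₀) - (p.2 - m₁)) γ :=
      (hX.sub hY).integrable one_le_two
    rw [integral_inner hXY, integral_sub (hX.integrable one_le_two) (hY.integrable one_le_two), hx0, hy0]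
    simp
  have hpt : (fun p : Rd d × Rd d => ‖p.1 - p.2‖ ^ 2) =ᵐ[γ] fun p => ‖m₀ - m₁‖ ^ 2 +
      2 * inner ℝ (m₀ - m₁) ((p.1 - m₀) - (p.2 - m₁)) +
      inner ℝ (p.1 - m₀) (Matrix.toEuclideanCLM (𝕜 := ℝ) (1 - A) (p.1 - m₀)) +
      inner ℝ (p.2 - m₁) (Matrix.toEuclideanCLM (𝕜 := ℝ) (1 - G * A * G) (p.2 - m₁)) + q p := by
    filter_upwards [ae_eq_of_isPlan_of_mul_mul_eq hS₁ hAS hAG h] with p hp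
    rw [← norm_add_sub_sq_eq hB hBA hG (m₀ - m₁) (p.1 - m₀) hp]
    congr 2
    abel
  -- The contributions of `-A` and `-G * A * G` to the constant coincide, which gives the factor `2`
  -- in front of the trace of `A * S₀`.
  have htr : (G * A * G * S₁).trace = (A * S₀).trace := by
    rw [← hAS]
    have : G * A * G * (A * S₀ * A) = G * (A * G * A) * S₀ * A := by simp only [mul_assoc]
    rw [this, hAG, Matrix.trace_mul_comm, ← mul_assoc, ← mul_assoc, hAG]
  obtain ⟨hint, hval⟩ := integrable_and_integral_const_add (‖m₀ - m₁‖ ^ 2) (hlint.const_mul 2)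
    (hxint (1 - A)) (hyint (1 - G * A * G)) hqint
  refine ⟨hint.congr hpt.symm, ?_⟩
  rw [integral_congr_ae hpt, hval, integral_const_mul, hlval, hxval, hyval]
  simp only [sub_mul, one_mul, Matrix.trace_sub, htr]
  ring

theorem map_affine_multivariateGaussian (hS₀ : S₀.PosSemidef) (hS₁ : S₁.PosSemidef)
    (hA : A.transpose = A) (hAS : A * S₀ * A = S₁) :
    (multivariateGaussian m₀ S₀).map
      (fun x => m₁ + Matrix.toEuclideanCLM (𝕜 := ℝ) A (x - m₀)) = multivariateGaussian m₁ S₁ := by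
  have hT : (fun x : Rd d => m₁ + Matrix.toEuclideanCLM (𝕜 := ℝ) A (x - m₀)) =
      (fun x => (m₁ - Matrix.toEuclideanCLM (𝕜 := ℝ) A m₀) + x) ∘
        Matrix.toEuclideanCLM (𝕜 := ℝ) A := by
    funext x
    simp only [map_sub, Function.comp_apply]
    abel
  rw [hT, ← Measure.map_map (by fun_prop) (by fun_prop)]
  apply IsGaussian.ext
  · rw [integral_map (by fun_prop) (by fun_prop), integral_map (by fun_prop) (by fun_prop)]
    simp only [id_eq, integral_id_multivariateGaussian]
    have hint : Integrable (fun x : Rd d => Matrix.toEuclideanCLM (𝕜 := ℝ) A x)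
        (multivariateGaussian m₀ S₀) :=
      (Matrix.toEuclideanCLM (𝕜 := ℝ) A).integrable_comp IsGaussian.integrable_id
    rw [integral_add (integrable_const _) hint,
      ContinuousLinearMap.integral_comp_comm _ IsGaussian.integrable_fun_id]
    simp
  · ext u v
    have hadj : (Matrix.toEuclideanCLM (𝕜 := ℝ) A).adjoint = Matrix.toEuclideanCLM (𝕜 := ℝ) A := by
      rw [← ContinuousLinearMap.star_eq_adjoint, ← map_star, Matrix.star_eq_conjTranspose,
        Matrix.conjTranspose_eq_transpose_of_trivial, hA]
    rw [covarianceBilin_map_const_add, covarianceBilin_map IsGaussian.memLp_two_id, hadj,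
      covarianceBilin_multivariateGaussian hS₀, covarianceBilin_multivariateGaussian hS₁,
      ← Matrix.inner_toEuclideanCLM, inner_toEuclideanCLM_left, hA, ← toEuclideanCLM_mul_apply,
      ← toEuclideanCLM_mul_apply, hAS, Matrix.inner_toEuclideanCLM]

/-- If `A` is positive semidefinite and `A S₀ A = S₁`, then the affine map with linear part `A`
induces an optimal plan, and it is the only one. -/
theorem isW2Optimal_map_and_unique (hS₀ : S₀.PosSemidef) (hS₁ : S₁.PosSemidef)
    (hA : A.PosSemidef) (hAS : A * S₀ * A = S₁) :
    IsW2Optimal (multivariateGaussian m₀ S₀) (multivariateGaussian m₁ S₁)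
      ((multivariateGaussian m₀ S₀).map
        fun x => (x, m₁ + Matrix.toEuclideanCLM (𝕜 := ℝ) A (x - m₀))) ∧
    ∀ γ, IsW2Optimal (multivariateGaussian m₀ S₀) (multivariateGaussian m₁ S₁) γ →
      γ = (multivariateGaussian m₀ S₀).map
        fun x => (x, m₁ + Matrix.toEuclideanCLM (𝕜 := ℝ) A (x - m₀)) := by
  obtain ⟨G, hG, hAG⟩ := exists_generalizedInverse hA
  set B := CFC.sqrt A
  have hBA : B * B = A := CFC.sqrt_mul_sqrt_self A hA.nonneg
  have hB : B.transpose = B := by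
    have : IsSelfAdjoint B := (CFC.sqrt_nonneg A).isSelfAdjoint
    simpa using (show B.IsHermitian from this).eq
  set T : Rd d → Rd d := fun x => m₁ + Matrix.toEuclideanCLM (𝕜 := ℝ) A (x - m₀) with hT
  have hTm : Measurable T := by fun_prop
  have hplan : IsPlan (multivariateGaussian m₀ S₀) (multivariateGaussian m₁ S₁)
      ((multivariateGaussian m₀ S₀).map fun x => (x, T x)) := by
    refine ⟨?_, ?_⟩
    · rw [Measure.map_map (by fun_prop) (by fun_prop)]
      exact Measure.map_id
    · rw [Measure.map_map (by fun_prop) (by fun_prop)]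
      have hAt : A.transpose = A := by rw [← hBA, Matrix.transpose_mul, hB]
      exact map_affine_multivariateGaussian hS₀ hS₁ hAt hAS
  have hcost := fun γ (h : IsPlan (multivariateGaussian m₀ S₀) (multivariateGaussian m₁ S₁) γ) =>
    h.integral_eq_add_integral_defect hS₀ hS₁ hB hBA hAS hG hAG
  set c := ‖m₀ - m₁‖ ^ 2 + S₀.trace + S₁.trace - 2 * (A * S₀).trace with hc
  have hnorm : ∀ z : Rd d, ‖Matrix.toEuclideanCLM (𝕜 := ℝ) B z‖ ^ 2 =
      inner ℝ z (Matrix.toEuclideanCLM (𝕜 := ℝ) A z) := fun z => by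
    rw [← real_inner_self_eq_norm_sq, inner_toEuclideanCLM_left, hB, ← toEuclideanCLM_mul_apply,
      hBA]
  -- On the graph the defect is the quadratic form of `A` at `z - G A z`, a vector in the kernel of
  -- `A` because `A * G * A = A`.
  have hintT : ∫ p : Rd d × Rd d, ‖p.1 - p.2‖ ^ 2
      ∂((multivariateGaussian m₀ S₀).map fun x => (x, T x)) = c := by
    rw [(hcost _ hplan).2.2, integral_map (by fun_prop) (by fun_prop), add_eq_left]
    refine integral_eq_zero_of_ae (ae_of_all _ fun x => ?_)
    simp only [hT, add_sub_cancel_left, hnorm, Pi.zero_apply]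
    generalize x - m₀ = z
    rw [map_sub (Matrix.toEuclideanCLM (𝕜 := ℝ) A), ← toEuclideanCLM_mul_apply,
      ← toEuclideanCLM_mul_apply, ← mul_assoc, hAG, sub_self, inner_zero_right]
  have hc0 : 0 ≤ c := hintT ▸ integral_nonneg fun _ => by positivity
  have hcostT : cost ((multivariateGaussian m₀ S₀).map fun x => (x, T x)) = ENNReal.ofReal c := by
    rw [cost_eq_ofReal_integral (hcost _ hplan).2.1, hintT]
  have hW : W2sq (multivariateGaussian m₀ S₀) (multivariateGaussian m₁ S₁) = ENNReal.ofReal c := by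
    refine le_antisymm ((iInf_le_of_le ⟨_, hplan⟩ le_rfl).trans hcostT.le) (le_iInf fun γ => ?_)
    rw [cost_eq_ofReal_integral (hcost _ γ.2).2.1, (hcost _ γ.2).2.2]
    gcongr
    exact le_add_of_nonneg_right (integral_nonneg fun _ => by positivity)
  refine ⟨⟨hplan, hcostT.trans hW.symm⟩, fun γ hγ => ?_⟩
  have hγc : ∫ p, ‖p.1 - p.2‖ ^ 2 ∂γ = c := by
    have h1 := hγ.2
    rw [hW, cost_eq_ofReal_integral (hcost _ hγ.1).2.1] at h1
    exact (ENNReal.ofReal_eq_ofReal_iff (integral_nonneg fun _ => by positivity) hc0).1 h1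
  rw [(hcost _ hγ.1).2.2, add_eq_left,
    integral_eq_zero_iff_of_nonneg (fun _ => by positivity) (hcost _ hγ.1).1] at hγc
  -- Optimality makes the defect vanish almost everywhere. Applying `B` once more gives `A (x - m₀)
  -- = A G (y - m₁) = y - m₁`, so `γ` lives on the graph of `T`.
  have hae : (fun p : Rd d × Rd d => p) =ᵐ[γ] fun p => (p.1, T p.1) := by
    filter_upwards [hγc, ae_eq_of_isPlan_of_mul_mul_eq hS₁ hAS hAG hγ.1] with p h1 h2
    have h3 : Matrix.toEuclideanCLM (𝕜 := ℝ) B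
        (p.1 - m₀ - Matrix.toEuclideanCLM (𝕜 := ℝ) G (p.2 - m₁)) = 0 := by
      simpa only [Pi.zero_apply, ne_eq, OfNat.ofNat_ne_zero, not_false_eq_true, pow_eq_zero_iff,
        norm_eq_zero] using h1
    have h4 := congrArg (Matrix.toEuclideanCLM (𝕜 := ℝ) B) h3
    rw [← toEuclideanCLM_mul_apply, hBA, map_zero, map_sub (Matrix.toEuclideanCLM (𝕜 := ℝ) A),
      ← toEuclideanCLM_mul_apply, h2, sub_eq_zero] at h4
    refine Prod.ext rfl ?_
    simp only [hT, h4]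
    abel
  calc γ = γ.map (fun p => p) := Measure.map_id'.symm
    _ = γ.map (fun p => (p.1, T p.1)) := Measure.map_congr hae
    _ = (γ.map Prod.fst).map fun x => (x, T x) := by
      rw [Measure.map_map (by fun_prop) (by fun_prop)]
      rfl
    _ = _ := by rw [hγ.1.1]

/-- With `R` the root of `S₀` and `Q` the root of `R * S₁ * R`, the matrix `A = R⁻¹ * Q * R⁻¹` is a
positive semidefinite solution of `A * S₀ * A = S₁`. -/
theorem isW2Optimal_gaussianMap_and_unique (m₀ m₁ : Rd d) (hS₀ : S₀.PosSemidef)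
    (hS₁ : S₁.PosSemidef) (hdet : S₀.det ≠ 0) :
    IsW2Optimal (multivariateGaussian m₀ S₀) (multivariateGaussian m₁ S₁)
      ((multivariateGaussian m₀ S₀).map fun x => (x, gaussianMap m₀ S₀ m₁ S₁ x)) ∧
    ∀ γ, IsW2Optimal (multivariateGaussian m₀ S₀) (multivariateGaussian m₁ S₁) γ →
      γ = (multivariateGaussian m₀ S₀).map fun x => (x, gaussianMap m₀ S₀ m₁ S₁ x) := by
  have hRR : CFC.sqrt S₀ * CFC.sqrt S₀ = S₀ := CFC.sqrt_mul_sqrt_self S₀ hS₀.nonneg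
  have hR : (CFC.sqrt S₀).PosSemidef := Matrix.nonneg_iff_posSemidef.1 (CFC.sqrt_nonneg S₀)
  set R := CFC.sqrt S₀
  have hRu : IsUnit R.det := by
    rw [isUnit_iff_ne_zero]
    intro h0
    apply hdet
    rw [← hRR, Matrix.det_mul, h0, zero_mul]
  have hRSR : (R * S₁ * R).PosSemidef := by
    have h := hS₁.mul_mul_conjTranspose_same R
    rwa [hR.isHermitian.eq] at h
  have hQQ : CFC.sqrt (R * S₁ * R) * CFC.sqrt (R * S₁ * R) = R * S₁ * R :=
    CFC.sqrt_mul_sqrt_self _ hRSR.nonneg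
  have hQ : (CFC.sqrt (R * S₁ * R)).PosSemidef :=
    Matrix.nonneg_iff_posSemidef.1 (CFC.sqrt_nonneg _)
  refine isW2Optimal_map_and_unique (A := R⁻¹ * CFC.sqrt (R * S₁ * R) * R⁻¹) hS₀ hS₁ ?_ ?_
  · have h := hQ.mul_mul_conjTranspose_same R⁻¹
    rwa [hR.isHermitian.inv.eq] at h
  · set Q := CFC.sqrt (R * S₁ * R)
    have h1 : R⁻¹ * R = 1 := Matrix.nonsing_inv_mul R hRu
    have h2 : R * R⁻¹ = 1 := Matrix.mul_nonsing_inv R hRu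
    calc R⁻¹ * Q * R⁻¹ * S₀ * (R⁻¹ * Q * R⁻¹)
        = R⁻¹ * Q * (R⁻¹ * R) * (R * R⁻¹) * Q * R⁻¹ := by rw [← hRR]; simp only [mul_assoc]
      _ = R⁻¹ * (Q * Q) * R⁻¹ := by rw [h1, h2]; simp only [mul_one, mul_assoc]
      _ = (R⁻¹ * R) * S₁ * (R * R⁻¹) := by rw [hQQ]; simp only [mul_assoc]
      _ = S₁ := by rw [h1, h2, one_mul, mul_one]

end OptimalMap

/-! ### Discrete optimal transport -/

section Discrete

variable {K₀ K₁ : ℕ} {π₀ : Fin K₀ → ℝ≥0} {π₁ : Fin K₁ → ℝ≥0}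

theorem exists_weightPlan_forall_le (hπ₀ : ∑ k, π₀ k = 1) (hπ₁ : ∑ l, π₁ l = 1)
    (c : Fin K₀ → Fin K₁ → ℝ≥0) :
    ∃ w, IsWeightPlan π₀ π₁ w ∧ ∀ w', IsWeightPlan π₀ π₁ w' →
      ∑ k, ∑ l, w k l * c k l ≤ ∑ k, ∑ l, w' k l * c k l := by
  have hclosed : IsClosed {w : Fin K₀ → Fin K₁ → ℝ≥0 | IsWeightPlan π₀ π₁ w} := by
    simp only [IsWeightPlan, ofPred_and, ofPred_forall]
    refine (isClosed_iInter fun k => isClosed_eq (by fun_prop) continuous_const).inter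
      (isClosed_iInter fun l => isClosed_eq (by fun_prop) continuous_const)
  have hK : IsCompact (Set.pi Set.univ fun k => Set.pi Set.univ fun _ => Icc 0 (π₀ k) :
      Set (Fin K₀ → Fin K₁ → ℝ≥0)) :=
    isCompact_univ_pi fun k => isCompact_univ_pi fun l => isCompact_Icc
  have hcomp : IsCompact {w : Fin K₀ → Fin K₁ → ℝ≥0 | IsWeightPlan π₀ π₁ w} := by
    refine hK.of_isClosed_subset hclosed fun w hw k _ l _ => ⟨zero_le, ?_⟩
    rw [← hw.1 k]
    exact Finset.single_le_sum (f := fun l => w k l) (fun _ _ => zero_le) (Finset.mem_univ l)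
  have hne : {w : Fin K₀ → Fin K₁ → ℝ≥0 | IsWeightPlan π₀ π₁ w}.Nonempty :=
    ⟨fun k l => π₀ k * π₁ l, fun k => by rw [← Finset.mul_sum, hπ₁, mul_one],
      fun l => by rw [← Finset.sum_mul, hπ₀, one_mul]⟩
  obtain ⟨w, hw, hmin⟩ := hcomp.exists_isMinOn hne
    (f := fun w : Fin K₀ → Fin K₁ → ℝ≥0 => ∑ k, ∑ l, w k l * c k l)
    (Continuous.continuousOn (by fun_prop))
  exact ⟨w, hw, fun w' hw' => hmin hw'⟩

/-- A weight matrix with too many nonzero entries can be perturbed inside its support without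
changing the marginals. -/
theorem exists_perturbation_of_lt_supportCard (w : Fin K₀ → Fin K₁ → ℝ≥0)
    (hw : K₀ + K₁ - 1 < supportCard w) :
    ∃ H : Fin K₀ → Fin K₁ → ℝ, H ≠ 0 ∧ (∀ k, ∑ l, H k l = 0) ∧ (∀ l, ∑ k, H k l = 0) ∧
      ∀ k l, w k l = 0 → H k l = 0 := by
  classical
  obtain _ | n := K₁
  · exfalso
    have h0 : supportCard w = 0 := by
      rw [supportCard, Set.eq_empty_of_isEmpty {p : Fin K₀ × Fin 0 | w p.1 p.2 ≠ 0},
        Set.ncard_empty]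
    omega
  -- The kernel of `Φ` consists of the perturbations sought. The last column sum is omitted, being
  -- implied by the others; this saves one dimension, so the target has dimension `K₀ + n` plus the
  -- number of zeros of `w`, less than `K₀ * (n + 1)`.
  let Φ : (Fin K₀ → Fin (n + 1) → ℝ) →ₗ[ℝ]
      (Fin K₀ → ℝ) × (Fin n → ℝ) × ({p : Fin K₀ × Fin (n + 1) // w p.1 p.2 = 0} → ℝ) :=
    { toFun := fun H => (fun k => ∑ l, H k l, fun l => ∑ k, H k l.castSucc,
        fun p => H p.1.1 p.1.2)
      map_add' := fun H H' => by
        simp only [Pi.add_apply, Finset.sum_add_distrib]; rfl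
      map_smul' := fun a H => by
        simp only [Pi.smul_apply, smul_eq_mul, ← Finset.mul_sum, RingHom.id_apply]; rfl }
  have hcard : Fintype.card {p : Fin K₀ × Fin (n + 1) // w p.1 p.2 = 0} + supportCard w =
      K₀ * (n + 1) := by
    have h1 : supportCard w = Fintype.card {p : Fin K₀ × Fin (n + 1) // ¬ w p.1 p.2 = 0} := by
      rw [← Nat.card_eq_fintype_card]
      rfl
    rw [h1, Fintype.card_subtype_compl]
    have h2 := Fintype.card_subtype_le fun p : Fin K₀ × Fin (n + 1) => w p.1 p.2 = 0
    simp only [Fintype.card_prod, Fintype.card_fin] at h2 ⊢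
    omega
  have hker : LinearMap.ker Φ ≠ ⊥ := by
    apply LinearMap.ker_ne_bot_of_finrank_lt
    simp only [Module.finrank_prod, Module.finrank_pi_fintype, Module.finrank_self,
      Finset.sum_const, Finset.card_univ, Fintype.card_fin, smul_eq_mul, mul_one]
    omega
  obtain ⟨H, hH, hH0⟩ := (Submodule.ne_bot_iff _).1 hker
  rw [LinearMap.mem_ker] at hH
  have hrow : ∀ k, ∑ l, H k l = 0 := fun k => congrFun (congrArg Prod.fst hH) k
  have hcol : ∀ l : Fin n, ∑ k, H k l.castSucc = 0 := fun l =>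
    congrFun (congrArg (fun x => x.2.1) hH) l
  refine ⟨H, hH0, hrow, fun l => ?_, fun k l hkl =>
    congrFun (congrArg (fun x => x.2.2) hH) ⟨(k, l), hkl⟩⟩
  refine Fin.lastCases ?_ hcol l
  have h1 : ∑ l, ∑ k, H k l = 0 := by
    rw [Finset.sum_comm]
    exact Finset.sum_eq_zero fun k _ => hrow k
  rw [Fin.sum_univ_castSucc, Finset.sum_eq_zero fun l _ => hcol l, zero_add] at h1
  exact h1

/-- Up to sign, a perturbation inside the support does not increase the cost. Following it until an
entry first reaches zero keeps the marginals and shrinks the support. -/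
theorem exists_smaller_support (c : Fin K₀ → Fin K₁ → ℝ≥0) {w : Fin K₀ → Fin K₁ → ℝ≥0}
    (hw : IsWeightPlan π₀ π₁ w) (hcard : K₀ + K₁ - 1 < supportCard w) :
    ∃ w', IsWeightPlan π₀ π₁ w' ∧ ∑ k, ∑ l, w' k l * c k l ≤ ∑ k, ∑ l, w k l * c k l ∧
      supportCard w' < supportCard w := by
  classical
  obtain ⟨H, hH0, hrow, hcol, hsupp, hcost⟩ : ∃ H : Fin K₀ → Fin K₁ → ℝ, H ≠ 0 ∧
      (∀ k, ∑ l, H k l = 0) ∧ (∀ l, ∑ k, H k l = 0) ∧ (∀ k l, w k l = 0 → H k l = 0) ∧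
      ∑ k, ∑ l, H k l * c k l ≤ 0 := by
    obtain ⟨H, hH0, hrow, hcol, hsupp⟩ := exists_perturbation_of_lt_supportCard w hcard
    rcases le_total (∑ k, ∑ l, H k l * c k l) 0 with h | h
    · exact ⟨H, hH0, hrow, hcol, hsupp, h⟩
    · refine ⟨-H, neg_ne_zero.2 hH0, fun k => ?_, fun l => ?_, fun k l hkl => ?_, ?_⟩
      · simp [hrow]
      · simp [hcol]
      · simp [hsupp k l hkl]
      · simpa using h
  -- A nonnegative matrix with zero row sums would vanish.
  have hneg : ∃ p : Fin K₀ × Fin K₁, H p.1 p.2 < 0 := by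
    by_contra! hcon
    apply hH0
    funext k l
    exact (Finset.sum_eq_zero_iff_of_nonneg fun l _ => hcon (k, l)).1 (hrow k) l
      (Finset.mem_univ l)
  -- The minimal ratio `w / -H` over the negative entries of `H` is the largest step keeping `w + t
  -- H` nonnegative, and it annihilates the entry `(k₀, l₀)`.
  obtain ⟨⟨k₀, l₀⟩, hp, hmin⟩ := (Finset.univ.filter fun p : Fin K₀ × Fin K₁ =>
    H p.1 p.2 < 0).exists_min_image (fun p => (w p.1 p.2 : ℝ) / -H p.1 p.2)
    (by obtain ⟨p, hp⟩ := hneg; exact ⟨p, by simpa using hp⟩)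
  simp only [Finset.mem_filter, Finset.mem_univ, true_and] at hp hmin
  set t : ℝ := (w k₀ l₀ : ℝ) / -H k₀ l₀ with ht
  have ht0 : 0 ≤ t := div_nonneg (w k₀ l₀).2 (by linarith)
  have hnn : ∀ k l, 0 ≤ (w k l : ℝ) + t * H k l := by
    intro k l
    rcases le_or_gt 0 (H k l) with h | h
    · have := (w k l).2
      positivity
    · have h1 := hmin (k, l) h
      rw [le_div_iff₀ (by linarith)] at h1
      linarith
  set w' : Fin K₀ → Fin K₁ → ℝ≥0 := fun k l => ⟨(w k l : ℝ) + t * H k l, hnn k l⟩ with hw'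
  have hcoe : ∀ k l, (w' k l : ℝ) = (w k l : ℝ) + t * H k l := fun k l => rfl
  refine ⟨w', ⟨fun k => ?_, fun l => ?_⟩, ?_, ?_⟩
  · apply NNReal.coe_injective
    rw [← hw.1 k]
    push_cast
    simp only [hcoe, Finset.sum_add_distrib, ← Finset.mul_sum, hrow, mul_zero, add_zero]
  · apply NNReal.coe_injective
    rw [← hw.2 l]
    push_cast
    simp only [hcoe, Finset.sum_add_distrib, ← Finset.mul_sum, hcol, mul_zero, add_zero]
  · rw [← NNReal.coe_le_coe]
    push_cast
    simp only [hcoe, add_mul, Finset.sum_add_distrib, mul_assoc, ← Finset.mul_sum]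
    have := mul_nonpos_of_nonneg_of_nonpos ht0 hcost
    linarith
  · refine Set.ncard_lt_ncard ?_ (Set.toFinite _)
    have hsub : {p : Fin K₀ × Fin K₁ | w' p.1 p.2 ≠ 0} ⊆ {p | w p.1 p.2 ≠ 0} := by
      intro p hp'
      rw [mem_ofPred_eq] at hp' ⊢
      refine fun hwp => hp' (NNReal.coe_injective ?_)
      rw [hcoe, hwp, hsupp _ _ hwp]
      simp
    refine (Set.ssubset_iff_of_subset hsub).2 ⟨(k₀, l₀), ?_, ?_⟩
    · rw [mem_ofPred_eq]
      exact fun h => hp.ne (hsupp _ _ h)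
    · rw [mem_ofPred_eq, not_not]
      apply NNReal.coe_injective
      rw [hcoe, ht]
      have := hp.ne
      simp only [NNReal.coe_zero]
      field_simp
      ring

/-- Some minimizer of a linear cost has at most `K₀ + K₁ - 1` nonzero entries. -/
theorem exists_weightPlan_forall_le_and_supportCard_le (hπ₀ : ∑ k, π₀ k = 1)
    (hπ₁ : ∑ l, π₁ l = 1) (c : Fin K₀ → Fin K₁ → ℝ≥0) :
    ∃ w, IsWeightPlan π₀ π₁ w ∧ (∀ w', IsWeightPlan π₀ π₁ w' →
      ∑ k, ∑ l, w k l * c k l ≤ ∑ k, ∑ l, w' k l * c k l) ∧ supportCard w ≤ K₀ + K₁ - 1 := by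
  obtain ⟨w₀, hw₀, hmin₀⟩ := exists_weightPlan_forall_le hπ₀ hπ₁ c
  obtain ⟨w, ⟨hw, hmin⟩, hsmall⟩ := exists_minimalFor_of_wellFoundedLT
    (fun w : Fin K₀ → Fin K₁ → ℝ≥0 => IsWeightPlan π₀ π₁ w ∧ ∀ w', IsWeightPlan π₀ π₁ w' →
      ∑ k, ∑ l, w k l * c k l ≤ ∑ k, ∑ l, w' k l * c k l) supportCard ⟨w₀, hw₀, hmin₀⟩
  refine ⟨w, hw, hmin, ?_⟩
  by_contra! hcard
  obtain ⟨w', hw', hle, hlt⟩ := exists_smaller_support c hw hcard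
  exact hlt.not_ge (hsmall ⟨hw', fun w'' hw'' => hle.trans (hmin w'' hw'')⟩ hlt.le)

end Discrete

/-! ### Optimal plans between Gaussian mixtures -/

section MixtureTransport

variable {d K₀ K₁ : ℕ} {π₀ : Fin K₀ → ℝ≥0} {π₁ : Fin K₁ → ℝ≥0}
  {ν₀ : Fin K₀ → Measure (Rd d)} {ν₁ : Fin K₁ → Measure (Rd d)}
  {g : Fin K₀ → Fin K₁ → Measure (Rd d × Rd d)} {w : Fin K₀ → Fin K₁ → ℝ≥0}

/-- `P t` as a continuous linear map. -/
noncomputable def interpolationCLM (d : ℕ) (t : ℝ) : Rd d × Rd d →L[ℝ] Rd d :=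
  (1 - t) • ContinuousLinearMap.fst ℝ (Rd d) (Rd d) + t • ContinuousLinearMap.snd ℝ (Rd d) (Rd d)

theorem measurable_P (t : ℝ) : Measurable (P t : Rd d × Rd d → Rd d) :=
  (interpolationCLM d t).continuous.measurable

theorem isGMM_sum_sum_smul {E : Type*} [TopologicalSpace E] [AddCommMonoid E] [Module ℝ E]
    [MeasurableSpace E] (hπ₀ : ∑ k, π₀ k = 1) (hw : IsWeightPlan π₀ π₁ w)
    {ρ : Fin K₀ → Fin K₁ → Measure E} (hρ : ∀ k l, IsGaussian (ρ k l)) {N : ℕ}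
    (hN : supportCard w ≤ N) : IsGMM N (∑ k, ∑ l, w k l • ρ k l) := by
  rw [← Fintype.sum_prod_type' (f := fun k l => w k l • ρ k l)]
  refine isGMM_sum_of_card_le (fun p : Fin K₀ × Fin K₁ => w p.1 p.2) _ ?_ (fun p => hρ _ _) hN
  rw [Fintype.sum_prod_type' (f := fun k l => w k l), ← hπ₀]
  exact Finset.sum_congr rfl fun k _ => hw.1 k

theorem W2sq_le_cost {μ ν : Measure (Rd d)} {γ : Measure (Rd d × Rd d)} (h : IsPlan μ ν γ) :
    W2sq μ ν ≤ cost γ :=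
  iInf_le_of_le ⟨γ, h⟩ le_rfl

theorem discreteCost_le_sum_cost {Γ : Fin K₀ → Fin K₁ → Measure (Rd d × Rd d)}
    (hΓ : ∀ k l, w k l ≠ 0 → IsPlan (ν₀ k) (ν₁ l) (Γ k l)) :
    discreteCost ν₀ ν₁ w ≤ cost (∑ k, ∑ l, w k l • Γ k l) := by
  rw [cost_sum_smul, discreteCost]
  refine Finset.sum_le_sum fun k _ => Finset.sum_le_sum fun l _ => ?_
  by_cases h : w k l = 0
  · simp [h]
  · gcongr
    exact W2sq_le_cost (hΓ k l h)

theorem cost_sum_smul_eq_discreteCost (hg : ∀ k l, IsW2Optimal (ν₀ k) (ν₁ l) (g k l)) :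
    cost (∑ k, ∑ l, w k l • g k l) = discreteCost ν₀ ν₁ w := by
  simp only [cost_sum_smul, discreteCost, (hg _ _).2]

theorem MW2sq_le_discreteCost (hπ₀ : ∑ k, π₀ k = 1)
    (hg : ∀ k l, IsW2Optimal (ν₀ k) (ν₁ l) (g k l)) (hgG : ∀ k l, IsGaussian (g k l))
    (hw : IsWeightPlan π₀ π₁ w) :
    MW2sq (∑ k, π₀ k • ν₀ k) (∑ l, π₁ l • ν₁ l) ≤ discreteCost ν₀ ν₁ w := by
  rw [← cost_sum_smul_eq_discreteCost hg]
  exact iInf_le_of_le ⟨_, isPlan_sum_smul hw fun k l => (hg k l).1, _,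
    isGMM_sum_sum_smul hπ₀ hw hgG le_rfl⟩ le_rfl

/-- Optimal weights and Gaussian optimal plans between components give an optimal plan. -/
theorem IsOptimalWeight.isMW2Optimal (hπ₀ : ∑ k, π₀ k = 1) (hν₀ : ∀ k, IsGaussian (ν₀ k))
    (hν₁ : ∀ l, IsGaussian (ν₁ l))
    (hg : ∀ k l, IsW2Optimal (ν₀ k) (ν₁ l) (g k l)) (hgG : ∀ k l, IsGaussian (g k l))
    (hw : IsOptimalWeight π₀ π₁ ν₀ ν₁ w) :
    IsMW2Optimal (∑ k, π₀ k • ν₀ k) (∑ l, π₁ l • ν₁ l) (∑ k, ∑ l, w k l • g k l) := by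
  refine ⟨isPlan_sum_smul hw.1 fun k l => (hg k l).1, ⟨_, isGMM_sum_sum_smul hπ₀ hw.1 hgG le_rfl⟩,
    ?_⟩
  rw [cost_sum_smul_eq_discreteCost hg]
  refine le_antisymm (le_iInf fun γ => ?_) (MW2sq_le_discreteCost hπ₀ hg hgG hw.1)
  obtain ⟨w', hw', Γ, hΓ, hγ⟩ := exists_plan_decomposition hν₀ hν₁ γ.2.1 γ.2.2
  rw [hγ]
  exact (hw.2 w' hw').trans (discreteCost_le_sum_cost hΓ)

/-- An optimal plan is a combination, with optimal weights, of optimal plans between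
components. -/
theorem IsMW2Optimal.exists_decomposition (hπ₀ : ∑ k, π₀ k = 1) (hν₀ : ∀ k, IsGaussian (ν₀ k))
    (hν₁ : ∀ l, IsGaussian (ν₁ l))
    (hg : ∀ k l, IsW2Optimal (ν₀ k) (ν₁ l) (g k l)) (hgG : ∀ k l, IsGaussian (g k l))
    (hfin : ∀ k l, W2sq (ν₀ k) (ν₁ l) ≠ ∞) {γ : Measure (Rd d × Rd d)}
    (hγ : IsMW2Optimal (∑ k, π₀ k • ν₀ k) (∑ l, π₁ l • ν₁ l) γ) :
    ∃ w, IsOptimalWeight π₀ π₁ ν₀ ν₁ w ∧ ∃ Γ : Fin K₀ → Fin K₁ → Measure (Rd d × Rd d),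
      (∀ k l, IsW2Optimal (ν₀ k) (ν₁ l) (Γ k l)) ∧ γ = ∑ k, ∑ l, w k l • Γ k l := by
  classical
  obtain ⟨w, hw, Γ, hΓ, hdec⟩ := exists_plan_decomposition hν₀ hν₁ hγ.1 hγ.2.1
  have hle : cost γ ≤ discreteCost ν₀ ν₁ w := hγ.2.2 ▸ MW2sq_le_discreteCost hπ₀ hg hgG hw
  -- The bound holds term by term, so one strict term of positive weight would make the finite
  -- discrete cost smaller than `cost γ`, contradicting `hle`.
  have hopt : ∀ k l, w k l ≠ 0 → cost (Γ k l) = W2sq (ν₀ k) (ν₁ l) := by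
    intro k l hkl
    refine le_antisymm ?_ (W2sq_le_cost (hΓ k l hkl))
    by_contra! hlt
    have hterm : ∀ p : Fin K₀ × Fin K₁, (w p.1 p.2 : ℝ≥0∞) * W2sq (ν₀ p.1) (ν₁ p.2) ≤
        (w p.1 p.2 : ℝ≥0∞) * cost (Γ p.1 p.2) := by
      intro p
      by_cases h : w p.1 p.2 = 0
      · simp [h]
      · gcongr
        exact W2sq_le_cost (hΓ _ _ h)
    have hlt' : ∑ p : Fin K₀ × Fin K₁, (w p.1 p.2 : ℝ≥0∞) * W2sq (ν₀ p.1) (ν₁ p.2) <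
        ∑ p : Fin K₀ × Fin K₁, (w p.1 p.2 : ℝ≥0∞) * cost (Γ p.1 p.2) := by
      rw [← Finset.add_sum_erase _ _ (Finset.mem_univ (k, l)),
        ← Finset.add_sum_erase Finset.univ (fun p : Fin K₀ × Fin K₁ =>
          (w p.1 p.2 : ℝ≥0∞) * cost (Γ p.1 p.2)) (Finset.mem_univ (k, l))]
      refine ENNReal.add_lt_add_of_lt_of_le ?_ ?_ (Finset.sum_le_sum fun p _ => hterm p)
      · exact (ENNReal.sum_lt_top.2 fun p _ =>
          ENNReal.mul_lt_top ENNReal.coe_lt_top (hfin _ _).lt_top).ne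
      · exact ENNReal.mul_lt_mul_right (by simpa using hkl) ENNReal.coe_ne_top hlt
    rw [Fintype.sum_prod_type, Fintype.sum_prod_type] at hlt'
    rw [hdec, cost_sum_smul] at hle
    exact hlt'.not_ge hle
  -- Where `w k l = 0` the plan `Γ k l` is uncontrolled and is replaced by the optimal `g k l`,
  -- which leaves the sum unchanged.
  refine ⟨w, ⟨hw, fun w' hw' => ?_⟩, fun k l => if w k l = 0 then g k l else Γ k l,
    fun k l => ?_, ?_⟩
  · refine (discreteCost_le_sum_cost hΓ).trans ?_
    rw [← hdec, hγ.2.2]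
    exact MW2sq_le_discreteCost hπ₀ hg hgG hw'
  · by_cases h : w k l = 0
    · simpa only [h, if_true] using hg k l
    · simp only [h, if_false]
      exact ⟨hΓ k l h, hopt k l h⟩
  · rw [hdec]
    refine Finset.sum_congr rfl fun k _ => Finset.sum_congr rfl fun l _ => ?_
    by_cases h : w k l = 0
    · simp [h]
    · simp [h]

theorem exists_isOptimalWeight_supportCard_le (hπ₀ : ∑ k, π₀ k = 1) (hπ₁ : ∑ l, π₁ l = 1)
    (hfin : ∀ k l, W2sq (ν₀ k) (ν₁ l) ≠ ∞) :
    ∃ w, IsOptimalWeight π₀ π₁ ν₀ ν₁ w ∧ supportCard w ≤ K₀ + K₁ - 1 := by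
  obtain ⟨w, hw, hmin, hcard⟩ := exists_weightPlan_forall_le_and_supportCard_le hπ₀ hπ₁
    fun k l => (W2sq (ν₀ k) (ν₁ l)).toNNReal
  have hcost : ∀ w : Fin K₀ → Fin K₁ → ℝ≥0, discreteCost ν₀ ν₁ w =
      ((∑ k, ∑ l, w k l * (W2sq (ν₀ k) (ν₁ l)).toNNReal : ℝ≥0) : ℝ≥0∞) := fun w => by
    push_cast
    simp only [ENNReal.coe_toNNReal (hfin _ _), discreteCost]
  refine ⟨w, ⟨hw, fun w' hw' => ?_⟩, hcard⟩
  rw [hcost, hcost]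
  exact_mod_cast hmin w' hw'

end MixtureTransport

end GMMTransport

/-! ### Barycenters and displacement interpolation -/

theorem mainTheorem7 {d K₀ K₁ : ℕ}
    (π₀ : Fin K₀ → ℝ≥0) (hπ₀ : ∑ k, π₀ k = 1)
    (m₀ : Fin K₀ → Rd d) (S₀ : Fin K₀ → Matrix (Fin d) (Fin d) ℝ)
    (hS₀ : ∀ k, (S₀ k).PosSemidef)
    (π₁ : Fin K₁ → ℝ≥0) (hπ₁ : ∑ l, π₁ l = 1)
    (m₁ : Fin K₁ → Rd d) (S₁ : Fin K₁ → Matrix (Fin d) (Fin d) ℝ)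
    (hS₁ : ∀ l, (S₁ l).PosSemidef)
    (ν₀ : Fin K₀ → Measure (Rd d)) (hν₀ : ∀ k, ν₀ k = multivariateGaussian (m₀ k) (S₀ k))
    (ν₁ : Fin K₁ → Measure (Rd d)) (hν₁ : ∀ l, ν₁ l = multivariateGaussian (m₁ l) (S₁ l))
    (μ₀ : Measure (Rd d)) (hμ₀ : μ₀ = ∑ k, π₀ k • ν₀ k)
    (μ₁ : Measure (Rd d)) (hμ₁ : μ₁ = ∑ l, π₁ l • ν₁ l) :
    -- every optimal plan interpolates through Gaussian mixtures of the stated form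
    (∀ γ, IsMW2Optimal μ₀ μ₁ γ →
      (∀ t ∈ Icc (0 : ℝ) 1, IsFiniteGMM (γ.map (P t))) ∧
      ∃ w, IsOptimalWeight π₀ π₁ ν₀ ν₁ w ∧
        ∃ ρ : Fin K₀ → Fin K₁ → ℝ → Measure (Rd d),
          (∀ k l, IsDisplacementInterpolation (ν₀ k) (ν₁ l) (ρ k l)) ∧
          ∀ t ∈ Icc (0 : ℝ) 1, γ.map (P t) = ∑ k, ∑ l, w k l • ρ k l t) ∧
    -- every optimal weight matrix arises, with Gaussian interpolations between the components
    (∀ w, IsOptimalWeight π₀ π₁ ν₀ ν₁ w →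
      ∃ γ, IsMW2Optimal μ₀ μ₁ γ ∧
        ∃ ρ : Fin K₀ → Fin K₁ → ℝ → Measure (Rd d),
          (∀ k l, IsDisplacementInterpolation (ν₀ k) (ν₁ l) (ρ k l) ∧
            ∀ t ∈ Icc (0 : ℝ) 1, IsGaussian (ρ k l t)) ∧
          ∀ t ∈ Icc (0 : ℝ) 1, γ.map (P t) = ∑ k, ∑ l, w k l • ρ k l t) ∧
    -- the explicit form of the interpolation between components when `S₀ k` is nonsingular
    (∀ k l, (S₀ k).det ≠ 0 →
      IsW2Optimal (ν₀ k) (ν₁ l)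
        ((ν₀ k).map fun x => (x, gaussianMap (m₀ k) (S₀ k) (m₁ l) (S₁ l) x)) ∧
      ∀ ρ, IsDisplacementInterpolation (ν₀ k) (ν₁ l) ρ → ∀ t ∈ Icc (0 : ℝ) 1,
        ρ t = (ν₀ k).map fun x =>
          (1 - t) • x + t • gaussianMap (m₀ k) (S₀ k) (m₁ l) (S₁ l) x) ∧
    -- the optimal plan can be chosen so that there are at most `K₀ + K₁ - 1` components
    (∃ w, IsOptimalWeight π₀ π₁ ν₀ ν₁ w ∧ supportCard w ≤ K₀ + K₁ - 1 ∧
      ∃ γ, IsMW2Optimal μ₀ μ₁ γ ∧ IsGMM (K₀ + K₁ - 1) γ ∧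
        ∃ ρ : Fin K₀ → Fin K₁ → ℝ → Measure (Rd d),
          (∀ k l, IsDisplacementInterpolation (ν₀ k) (ν₁ l) (ρ k l) ∧
            ∀ t ∈ Icc (0 : ℝ) 1, IsGaussian (ρ k l t)) ∧
          ∀ t ∈ Icc (0 : ℝ) 1,
            γ.map (P t) = ∑ k, ∑ l, w k l • ρ k l t ∧
            IsGMM (K₀ + K₁ - 1) (γ.map (P t))) := by
  obtain rfl : ν₀ = fun k => multivariateGaussian (m₀ k) (S₀ k) := funext hν₀
  obtain rfl : ν₁ = fun l => multivariateGaussian (m₁ l) (S₁ l) := funext hν₁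
  subst hμ₀ hμ₁
  choose g hgG hg using fun k l => exists_isGaussian_isW2Optimal (m₀ k) (m₁ l) (hS₀ k) (hS₁ l)
  have hfin := fun k l => W2sq_multivariateGaussian_ne_top (m₀ k) (m₁ l) (hS₀ k) (hS₁ l)
  have hG₀ := fun k => isGaussian_multivariateGaussian (μ := m₀ k) (S := S₀ k)
  have hG₁ := fun l => isGaussian_multivariateGaussian (μ := m₁ l) (S := S₁ l)
  have hρ : ∀ k l (t : ℝ), IsGaussian ((g k l).map (P t)) := fun k l t => by
    have := hgG k l
    exact isGaussian_map (interpolationCLM d t)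
  refine ⟨fun γ hγ => ⟨fun t _ => ?_, ?_⟩, fun w hw => ?_, fun k l hdet => ?_, ?_⟩
  · obtain ⟨K, hK⟩ := hγ.2.1
    exact ⟨K, hK.map (interpolationCLM d t)⟩
  · obtain ⟨w, hw, Γ, hΓ, rfl⟩ := hγ.exists_decomposition hπ₀ hG₀ hG₁ hg hgG hfin
    exact ⟨w, hw, fun k l t => (Γ k l).map (P t), fun k l => ⟨_, hΓ k l, fun _ _ => rfl⟩,
      fun t _ => map_sum_sum_smul _ _ (measurable_P t)⟩
  · exact ⟨_, hw.isMW2Optimal hπ₀ hG₀ hG₁ hg hgG, fun k l t => (g k l).map (P t),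
      fun k l => ⟨⟨_, hg k l, fun _ _ => rfl⟩, fun t _ => hρ k l t⟩,
      fun t _ => map_sum_sum_smul _ _ (measurable_P t)⟩
  · obtain ⟨hopt, huniq⟩ :=
      isW2Optimal_gaussianMap_and_unique (m₀ k) (m₁ l) (hS₀ k) (hS₁ l) hdet
    refine ⟨hopt, ?_⟩
    rintro ρ ⟨γ, hγ, hργ⟩ t ht
    have hmeas : Measurable (gaussianMap (m₀ k) (S₀ k) (m₁ l) (S₁ l)) := by
      unfold gaussianMap
      fun_prop
    rw [hργ t ht, huniq γ hγ, Measure.map_map (measurable_P t) (by fun_prop)]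
    rfl
  · obtain ⟨w, hw, hcard⟩ := exists_isOptimalWeight_supportCard_le hπ₀ hπ₁ hfin
    refine ⟨w, hw, hcard, _, hw.isMW2Optimal hπ₀ hG₀ hG₁ hg hgG,
      isGMM_sum_sum_smul hπ₀ hw.1 hgG hcard, fun k l t => (g k l).map (P t),
      fun k l => ⟨⟨_, hg k l, fun _ _ => rfl⟩, fun t _ => hρ k l t⟩, fun t _ => ?_⟩
    rw [map_sum_sum_smul _ _ (measurable_P t)]
    exact ⟨rfl, isGMM_sum_sum_smul hπ₀ hw.1 (fun k l => hρ k l t) hcard⟩
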